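/- **Setting.** For a set $S$ in a Euclidean space, the $k$-nearest neighbour graph $\mathcal G_k(S)$ has vertex set $S$, and two vertices are adjacent if either is among the $k$ nearest neighbours of the other; here $y\in S\setminus\{x\}$ is among the $k$ nearest neighbours of $x$ if fewer than $k$ points of $S\setminus\{x\}$ are strictly closer to $x$ than $y$ is. Let $(x_1,y_1),\dots,(x_N,y_N)\in\mathbb R^n\times\mathbb R$ be training data and $y=(y_1,\dots,y_N)$. For $W\in\mathbb R^{m\times n}$ and $a\in\mathbb R^m$ let $\Phi_{W,a}(x)=\langle a,\sigma(\tfrac1{\sqrt m}Wx)\rangle$, where $\sigma(z)=\max(0,z)$ acts entrywise, and $L(W,a)=\frac12\sum_{i=1}^N(\Phi_{W,a}(x_i)-y_i)^2$. The initialization $W(0)$, $a$ is random: all entries are independent, $W_{ij}(0)\sim\mathcal N(0,1)$ and $a_i\sim\mathrm{Unif}(\{-1,1\})$. The second layer $a$ is kept fixed, and the first layer is trained by gradient descent $W(l+1)=W(l)-\eta\,\frac{\partial L}{\partial W}(W(l),a)$, where the gradient is given by the chain rule with $\sigma'(z)=1_{\{z\ge 0\}}$. Let $u(0)=(\Phi_{W(0),a}(x_1),\dots,\Phi_{W(0),a}(x_N))$.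 Let $\lambda_0$ be the smallest eigenvalue of the Gram matrix $H^\infty\in\mathbb R^{N\times N}$, $H^\infty_{ij}=\mathbb E_{w\sim\mathcal N(0,I_n)}\big[x_i^\top x_j\,1_{\{w^\top x_i\ge0,\ w^\top x_j\ge0\}}\big]$. **Theorem.** There is an absolute constant $\kappa>0$, and for every $C$ a constant $K>0$ depending only on $C$, such that the following holds for all $n,m,N,k$, all training data as above, every finite set $X\subset\mathbb R^n$, and all real $\epsilon,\delta,\eta$. Assume that $0<\epsilon<1$ and $$\min_{\substack{Y\subset X\setminus\{x\}\\|Y|=k}}\max_{y\in Y}\|x-y\|\le\frac{1-\epsilon}{1+\epsilon}\min_{\substack{Y\subset X\setminus\{x\}\\|Y|=k+1}}\max_{y\in Y}\|x-y\|\qquad\text{for all }x\in X$$ (with $\min\emptyset=\infty$ and $\max\emptyset=0$), and that $$\lambda_0>0,\qquad \|x_i\|=1\ \text{ and }\ |y_i|\le C\ \text{ for all } i,\qquad \delta>0,\qquad m\ge K\frac{N^6}{\lambda_0^4\delta^3},\qquad 0<\eta\le\kappa\frac{\lambda_0}{N^2}.$$ Then, with probability at least $$1-\delta-|X|(|X|-1)\exp\Big(\frac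 m4\Big(\frac{\epsilon^3}8-\frac{\epsilon^2}4\Big)\Big)$$ over the random initialization, the following implication holds: if $$m\ge\frac{64N\|u(0)-y\|^2}{\epsilon^2\lambda_0^2},$$ then for every number $l\ge0$ of gradient descent steps the map $\psi(x)=\frac1{\sqrt m}W(l)x$ is a graph isomorphism from $\mathcal G_k(X)$ onto $\mathcal G_k(X(l))$, where $X(l)=\{\frac1{\sqrt m}W(l)x:x\in X\}$. -/

import Mathlib

open MeasureTheory ProbabilityTheory
open scoped ENNReal Matrix

namespace FeatureGeometry

/-! ### Nearest neighbour graphs -/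

/-- `y` is among the `k` nearest neighbours of `x` in `S`: it is a point of `S` other than `x`, and
fewer than `k` points of `S` other than `x` are strictly closer to `x` than `y` is. -/
def IsNearestNeighbor {E : Type*} [MetricSpace E] (k : ℕ) (S : Set E) (x y : E) : Prop :=
  y ∈ S ∧ y ≠ x ∧ {z : E | z ∈ S ∧ z ≠ x ∧ dist x z < dist x y}.encard < (k : ℕ∞)

/-- The `k`-nearest neighbour graph on the vertex set `S`: two vertices are adjacent if either is
among the `k` nearest neighbours of the other. -/
def knnGraph {E : Type*} [MetricSpace E] (k : ℕ) (S : Set E) : SimpleGraph S where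
  Adj x y := IsNearestNeighbor k S x y ∨ IsNearestNeighbor k S y x
  symm := ⟨fun _ _ h => h.symm⟩
  loopless := ⟨fun _ h => h.elim (fun h => h.2.1 rfl) (fun h => h.2.1 rfl)⟩

/-- The map `x ↦ f x` from `S` onto `f '' S` is an isomorphism between the `k`-nearest neighbour
graphs of `S` and of `f '' S`. -/
def IsKnnGraphIso {E F : Type*} [MetricSpace E] [MetricSpace F] (k : ℕ) (S : Set E)
    (f : E → F) : Prop :=
  ∃ e : knnGraph k S ≃g knnGraph k (f '' S), ∀ x : S, (e x : F) = f x

/-- `min_{Y ⊆ X ∖ {x}, |Y| = k} max_{y ∈ Y} ‖x - y‖`, with the conventions `min ∅ = ∞` and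
`max ∅ = 0`. -/
noncomputable def knnRadius {E : Type*} [MetricSpace E] (k : ℕ) (X : Finset E) (x : E) : ℝ≥0∞ :=
  ⨅ (Y : Finset E) (_ : Y ⊆ X ∧ x ∉ Y ∧ Y.card = k), ⨆ y ∈ Y, edist x y

/-! ### The two-layer ReLU network and gradient descent on its first layer -/

/-- The ReLU activation. -/
noncomputable def relu (z : ℝ) : ℝ := max 0 z

/-- The derivative of ReLU, with the usual convention `relu' 0 = 1`. -/
noncomputable def reluDeriv (z : ℝ) : ℝ := if 0 ≤ z then 1 else 0

/-- The first layer before the nonlinearity, `x ↦ W x / √m`. -/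
noncomputable def linearLayer {m n : ℕ} (W : Matrix (Fin m) (Fin n) ℝ)
    (x : EuclideanSpace ℝ (Fin n)) : EuclideanSpace ℝ (Fin m) :=
  WithLp.toLp 2 ((Real.sqrt m)⁻¹ • (W *ᵥ x.ofLp))

/-- The network `Φ(x) = ⟨a, σ(W x / √m)⟩`. -/
noncomputable def network {m n : ℕ} (a : Fin m → ℝ) (W : Matrix (Fin m) (Fin n) ℝ)
    (x : EuclideanSpace ℝ (Fin n)) : ℝ :=
  ∑ r, a r * relu (linearLayer W x r)

/-- The vector `u = (Φ(x₁), …, Φ(x_N))` of predictions. -/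
noncomputable def predictions {m n N : ℕ} (x : Fin N → EuclideanSpace ℝ (Fin n)) (a : Fin m → ℝ)
    (W : Matrix (Fin m) (Fin n) ℝ) : EuclideanSpace ℝ (Fin N) :=
  WithLp.toLp 2 fun i => network a W (x i)

/-- The empirical loss `L(W, a) = ½ ∑ᵢ (Φ(xᵢ) - yᵢ)²`. -/
noncomputable def loss {m n N : ℕ} (x : Fin N → EuclideanSpace ℝ (Fin n))
    (y : EuclideanSpace ℝ (Fin N)) (a : Fin m → ℝ) (W : Matrix (Fin m) (Fin n) ℝ) : ℝ :=
  (1 / 2) * ∑ i, (network a W (x i) - y i) ^ 2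

/-- The gradient `∂L(W, a)/∂W`, computed by the chain rule with `reluDeriv` for the derivative of
the activation. -/
noncomputable def lossGrad {m n N : ℕ} (x : Fin N → EuclideanSpace ℝ (Fin n))
    (y : EuclideanSpace ℝ (Fin N)) (a : Fin m → ℝ) (W : Matrix (Fin m) (Fin n) ℝ) :
    Matrix (Fin m) (Fin n) ℝ :=
  Matrix.of fun r j => ∑ i, (network a W (x i) - y i) *
    (a r * reluDeriv (linearLayer W (x i) r) * ((Real.sqrt m)⁻¹ * x i j))

/-- Away from the kinks of the activation, `lossGrad` is the gradient of the loss in the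
first-layer weights: it gives the derivative in every direction `V`. -/
theorem hasDerivAt_loss {m n N : ℕ} (x : Fin N → EuclideanSpace ℝ (Fin n))
    (y : EuclideanSpace ℝ (Fin N)) (a : Fin m → ℝ) (W V : Matrix (Fin m) (Fin n) ℝ)
    (hW : ∀ i r, linearLayer W (x i) r ≠ 0) :
    HasDerivAt (fun t : ℝ => loss x y a (W + t • V))
      (∑ r, ∑ j, lossGrad x y a W r j * V r j) 0 := by
  have hrelu : ∀ z : ℝ, z ≠ 0 → HasDerivAt relu (reluDeriv z) z := by
    intro z hz
    rcases lt_or_gt_of_ne hz with h | h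
    · have h1 : reluDeriv z = 0 := by simp [reluDeriv, h]
      rw [h1]
      refine (hasDerivAt_const z (0 : ℝ)).congr_of_eventuallyEq ?_
      filter_upwards [Iio_mem_nhds h] with t ht
      simp [relu, le_of_lt (Set.mem_Iio.1 ht)]
    · have h1 : reluDeriv z = 1 := by simp [reluDeriv, h.le]
      rw [h1]
      refine (hasDerivAt_id z).congr_of_eventuallyEq ?_
      filter_upwards [Ioi_mem_nhds h] with t ht
      simp [relu, le_of_lt (Set.mem_Ioi.1 ht)]
  have hlin : ∀ i r, HasDerivAt (fun t : ℝ => linearLayer (W + t • V) (x i) r)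
      (linearLayer V (x i) r) 0 := by
    intro i r
    have h1 : (fun t : ℝ => linearLayer (W + t • V) (x i) r)
        = fun t : ℝ => linearLayer W (x i) r + t * linearLayer V (x i) r := by
      funext t
      simp [linearLayer, Matrix.add_mulVec, Matrix.smul_mulVec]
      ring
    rw [h1]
    simpa using ((hasDerivAt_id (0 : ℝ)).mul_const (linearLayer V (x i) r)).const_add
      (linearLayer W (x i) r)
  have hnet : ∀ i, HasDerivAt (fun t : ℝ => network a (W + t • V) (x i))
      (∑ r, a r * (reluDeriv (linearLayer W (x i) r) * linearLayer V (x i) r)) 0 := by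
    intro i
    unfold network
    refine HasDerivAt.fun_sum fun r _ => HasDerivAt.const_mul _ ?_
    have h2 := hrelu _ (hW i r)
    have h3 : linearLayer (W + (0 : ℝ) • V) (x i) r = linearLayer W (x i) r := by simp
    rw [← h3] at h2
    have h4 := HasDerivAt.comp (0 : ℝ) h2 (hlin i r)
    rw [h3] at h4
    exact h4
  have hloss : HasDerivAt (fun t : ℝ => loss x y a (W + t • V))
      ((1 / 2) * ∑ i, 2 * (network a W (x i) - y i) *
        (∑ r, a r * (reluDeriv (linearLayer W (x i) r) * linearLayer V (x i) r))) 0 := by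
    unfold loss
    refine HasDerivAt.const_mul _ (HasDerivAt.fun_sum fun i _ => ?_)
    simpa using ((hnet i).sub_const (y i)).fun_pow 2
  convert hloss using 1
  have hV : ∀ i r, linearLayer V (x i) r = ∑ j, (Real.sqrt m)⁻¹ * (V r j * x i j) := by
    intro i r
    simp [linearLayer, Matrix.mulVec, dotProduct, Finset.mul_sum]
  simp only [hV, lossGrad, Matrix.of_apply, Finset.mul_sum, Finset.sum_mul]
  rw [Finset.sum_comm' (s := (Finset.univ : Finset (Fin N))) (t := fun _ => Finset.univ)
    (s' := fun _ => Finset.univ) (t' := Finset.univ) (by simp)]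
  refine Finset.sum_congr rfl fun r _ => ?_
  rw [Finset.sum_comm]
  refine Finset.sum_congr rfl fun i _ => Finset.sum_congr rfl fun j _ => ?_
  ring

/-- The first-layer weights `W(l)` after `l` steps of gradient descent with step size `η`, started
at `W₀`, with the second layer `a` kept fixed. -/
noncomputable def gdWeights {m n N : ℕ} (x : Fin N → EuclideanSpace ℝ (Fin n))
    (y : EuclideanSpace ℝ (Fin N)) (η : ℝ) (a : Fin m → ℝ) (W₀ : Matrix (Fin m) (Fin n) ℝ) :
    ℕ → Matrix (Fin m) (Fin n) ℝ
  | 0 => W₀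
  | l + 1 => gdWeights x y η a W₀ l - η • lossGrad x y a (gdWeights x y η a W₀ l)

/-! ### Random initialization and the Gram matrix -/

/-- The uniform distribution on `{-1, 1}`. -/
noncomputable def signLaw : Measure ℝ :=
  (2⁻¹ : ℝ≥0∞) • (Measure.dirac (-1) + Measure.dirac 1)

/-- The law of the initialization `(W(0), a)`: all entries are independent, those of `W(0)` are
standard normal and those of `a` are uniform on `{-1, 1}`. -/
noncomputable def initLaw (m n : ℕ) :
    Measure ((Fin m → Fin n → ℝ) × (Fin m → ℝ)) :=
  Measure.prod (Measure.pi fun _ : Fin m => Measure.pi fun _ : Fin n => gaussianReal 0 1)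
    (Measure.pi fun _ : Fin m => signLaw)

instance : IsProbabilityMeasure signLaw := ⟨by
  simp only [signLaw, Measure.smul_apply, Measure.add_apply, measure_univ, smul_eq_mul]
  rw [one_add_one_eq_two, ENNReal.inv_mul_cancel two_ne_zero ENNReal.ofNat_ne_top]⟩

instance (m n : ℕ) : IsProbabilityMeasure (initLaw m n) := by
  unfold initLaw
  infer_instance

/-- The Gram matrix `H^∞ᵢⱼ = 𝔼 [xᵢᵀ xⱼ 1_{wᵀxᵢ ≥ 0, wᵀxⱼ ≥ 0}]`, where `w` has independent
standard normal entries. -/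
noncomputable def gramMatrix {n N : ℕ} (x : Fin N → EuclideanSpace ℝ (Fin n)) :
    Matrix (Fin N) (Fin N) ℝ :=
  Matrix.of fun i j =>
    ∫ w : Fin n → ℝ,
      Set.indicator {w | 0 ≤ w ⬝ᵥ (x i).ofLp ∧ 0 ≤ w ⬝ᵥ (x j).ofLp}
        (fun _ => (x i).ofLp ⬝ᵥ (x j).ofLp) w
      ∂(Measure.pi fun _ : Fin n => gaussianReal 0 1)

/-- The smallest eigenvalue `λ₀` of the Gram matrix. -/
noncomputable def gramMinEigenvalue {n N : ℕ} (x : Fin N → EuclideanSpace ℝ (Fin n)) : ℝ :=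
  sInf (spectrum ℝ (gramMatrix x))

end FeatureGeometry

open FeatureGeometry

/-!
Two estimates on distances combine. At initialization `x ↦ W(0) x / √m` is a Gaussian random
projection, so by the Johnson–Lindenstrauss lemma (`weightLaw_distortion_le`, Chernoff bounds for
sums of squares of standard normal variables) it distorts the distances within `X` by factors
between `√(1 - ε / 2)` and `√(1 + ε / 2)`. During training the network is in the lazy regime: each
row of `W(l)` stays within `D = 4 √N ‖u(0) - y‖ / (√m λ₀)` of its initial value
(`norm_gdWeights_sub_le`), so that `W(l) / √m` differs from `W(0) / √m` by at most `D` in operator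
norm, and the width assumption in the conclusion says exactly that `D ≤ ε / 2`. Altogether the layer
distorts distances by factors strictly between `1 - ε` and `1 + ε`, and the gap between the `k`-th
and `(k + 1)`-st nearest neighbour radii then keeps the sets of `k` nearest neighbours unchanged
(`isKnnGraphIso_of_distortion`).

The lazy regime rests on the linearization of the residuals `z(l) = u(l) - y`. A neuron whose
initial preactivation at every data point exceeds `R ≥ D` in absolute value never changes its
activation pattern, so one gradient step acts as `z ↦ z - η H z` with the initial empirical Gram
matrix `H`, up to an error controlled by the number of neurons near a kink
(`abs_predictions_step_add_le`). When `H` is coercive with constant `3 λ₀ / 4`, the residuals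
contract by `1 - η λ₀ / 4` (`norm_residual_step_le`), and the geometric series of the step lengths
sums to `D`. The induction is self-consistent: smallness of the displacement gives contraction, and
contraction gives smallness of the displacement.

What is needed of the initialization is collected in `GoodInit`, and holds with the required
probability by a union bound (`initLaw_not_goodInit_le`): Chebyshev's inequality for the entries of
`H`, Markov's inequality for the number of neurons near a kink (the normal density is bounded) and
for `‖u(0) - y‖²` (random signs are uncorrelated), and the Johnson–Lindenstrauss lemma.
-/

namespace FeatureGeometry

/-! ### Nearest neighbour graphs under near-isometries -/

/-- If the points of `S ∖ {x}` outside `Y` are all farther from `x` than those of `Y`, and `Y` has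
`k` elements unless it exhausts `S ∖ {x}` with fewer, then `Y` is the set of `k` nearest neighbours
of `x`. -/
theorem isNearestNeighbor_iff_mem {E : Type*} [MetricSpace E] {k : ℕ} {S : Set E} {x : E}
    {Y : Finset E} (hYS : ∀ y ∈ Y, y ∈ S) (hxY : x ∉ Y) (hcard : Y.card ≤ k)
    (hsep : ∀ z ∈ S, z ≠ x → z ∉ Y → k ≤ Y.card ∧ ∀ y ∈ Y, dist x y < dist x z) (y : E) :
    IsNearestNeighbor k S x y ↔ y ∈ Y := by
  constructor
  · rintro ⟨hyS, hyx, hlt⟩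
    by_contra hyY
    obtain ⟨hk, hd⟩ := hsep y hyS hyx hyY
    have hsub : (Y : Set E) ⊆ {z : E | z ∈ S ∧ z ≠ x ∧ dist x z < dist x y} := fun z hz =>
      ⟨hYS z hz, fun h => hxY (h ▸ hz), hd z hz⟩
    have h1 := Set.encard_le_encard hsub
    rw [Set.encard_coe_eq_coe_finsetCard] at h1
    exact absurd (lt_of_le_of_lt h1 hlt) (not_lt.2 (by exact_mod_cast hk))
  · intro hyY
    refine ⟨hYS y hyY, fun h => hxY (h ▸ hyY), ?_⟩
    classical
    have hsub : {z : E | z ∈ S ∧ z ≠ x ∧ dist x z < dist x y} ⊆ (Y.erase y : Finset E) := by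
      rintro z ⟨hzS, hzx, hz⟩
      simp only [Finset.coe_erase, Set.mem_sdiff, Finset.mem_coe, Set.mem_singleton_iff]
      refine ⟨?_, fun h => absurd hz (by simp [h])⟩
      by_contra hzY
      exact absurd ((hsep z hzS hzx hzY).2 y hyY) (not_lt.2 hz.le)
    have h1 := Set.encard_le_encard hsub
    rw [Set.encard_coe_eq_coe_finsetCard] at h1
    refine lt_of_le_of_lt h1 ?_
    have h2 := Finset.card_erase_lt_of_mem hyY
    exact_mod_cast lt_of_lt_of_le h2 hcard

/-- The gap between consecutive nearest neighbour radii singles out a set `Y` of nearest neighbours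
of `p`, which is either all of `X ∖ {p}` or has `k` elements and is closer to `p` than the rest of
`X` by the factor `(1 - ε) / (1 + ε)`. -/
theorem exists_separated_of_knnRadius {E : Type*} [MetricSpace E] {k : ℕ} {X : Finset E} {p : E}
    {ε : ℝ} (hε0 : 0 < ε) (hε1 : ε < 1)
    (h : knnRadius k X p ≤ ENNReal.ofReal ((1 - ε) / (1 + ε)) * knnRadius (k + 1) X p) :
    ∃ Y : Finset E, (∀ y ∈ Y, y ∈ X) ∧ p ∉ Y ∧ Y.card ≤ k ∧
      ∀ z ∈ X, z ≠ p → z ∉ Y →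
        k ≤ Y.card ∧ ∀ y ∈ Y, (1 + ε) * dist p y ≤ (1 - ε) * dist p z := by
  classical
  rcases le_or_gt (X.erase p).card k with hle | hgt
  · exact ⟨X.erase p, fun y hy => Finset.mem_of_mem_erase hy, Finset.notMem_erase p X, hle,
      fun z hz hzp hzY => absurd (Finset.mem_erase.2 ⟨hzp, hz⟩) hzY⟩
  have hne : ((X.erase p).powersetCard k).Nonempty := Finset.powersetCard_nonempty.2 hgt.le
  obtain ⟨Y, hY, hmin⟩ := Finset.exists_min_image _ (fun Y : Finset E => ⨆ y ∈ Y, edist p y) hne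
  obtain ⟨hYX, hYk⟩ := Finset.mem_powersetCard.1 hY
  have hpY : p ∉ Y := fun hp => Finset.notMem_erase p X (hYX hp)
  refine ⟨Y, fun y hy => Finset.mem_of_mem_erase (hYX hy), hpY, hYk.le, fun z hz hzp hzY =>
    ⟨hYk.ge, fun y hy => ?_⟩⟩
  set a := ⨆ y ∈ Y, edist p y with ha
  have ha1 : a ≤ knnRadius k X p := by
    refine le_iInf₂ fun Y' hY' => hmin Y' ?_
    exact Finset.mem_powersetCard.2 ⟨fun w hw => Finset.mem_erase.2
      ⟨fun hwp => hY'.2.1 (hwp ▸ hw), hY'.1 hw⟩, hY'.2.2⟩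
  have ha2 : knnRadius (k + 1) X p ≤ max (edist p z) a := by
    have hins : insert z Y ⊆ X ∧ p ∉ insert z Y ∧ (insert z Y).card = k + 1 :=
      ⟨Finset.insert_subset hz fun y hy => Finset.mem_of_mem_erase (hYX hy),
        by simp [hpY, hzp.symm], by rw [Finset.card_insert_of_notMem hzY, hYk]⟩
    refine (iInf₂_le (insert z Y) hins).trans ?_
    rw [Finset.iSup_insert]
  have hya : edist p y ≤ a := le_iSup₂ (f := fun y (_ : y ∈ Y) => edist p y) y hy
  have hafin : a ≠ ∞ := by
    rw [ha, ← Finset.sup_eq_iSup]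
    exact ((Finset.sup_lt_iff ENNReal.coe_lt_top).2 fun y _ => edist_lt_top p y).ne
  have hdy : 0 < dist p y := dist_pos.2 fun h => hpY (h ▸ hy)
  have hρ : 0 < (1 - ε) / (1 + ε) := div_pos (by linarith) (by linarith)
  have hmain : a ≤ ENNReal.ofReal ((1 - ε) / (1 + ε)) * max (edist p z) a :=
    ha1.trans (h.trans (by gcongr))
  have hmain' : a.toReal ≤ (1 - ε) / (1 + ε) * max (dist p z) a.toReal := by
    have h1 := ENNReal.toReal_mono (ENNReal.mul_ne_top ENNReal.ofReal_ne_top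
      (max_lt (edist_lt_top p z) (lt_top_iff_ne_top.2 hafin)).ne) hmain
    rwa [ENNReal.toReal_mul, ENNReal.toReal_ofReal hρ.le,
      ENNReal.toReal_max (edist_ne_top _ _) hafin, edist_dist,
      ENNReal.toReal_ofReal dist_nonneg] at h1
  have hya' : dist p y ≤ a.toReal := by
    have h1 := ENNReal.toReal_mono hafin hya
    rwa [edist_dist, ENNReal.toReal_ofReal dist_nonneg] at h1
  rw [div_mul_eq_mul_div, le_div_iff₀ (by linarith)] at hmain'
  rcases max_cases (dist p z) a.toReal with ⟨hm, _⟩ | ⟨hm, _⟩ <;> rw [hm] at hmain'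
  · nlinarith
  · nlinarith

/-- A map that distorts the distances between distinct points of `X` by factors strictly between
`1 - ε` and `1 + ε` preserves the `k`-nearest neighbour graph of `X`, provided that the nearest
neighbour radii have a gap. -/
theorem isKnnGraphIso_of_distortion {E F : Type*} [MetricSpace E] [MetricSpace F] {k : ℕ}
    {X : Finset E} {ε : ℝ} (hε0 : 0 < ε) (hε1 : ε < 1)
    (hX : ∀ p ∈ X, knnRadius k X p
      ≤ ENNReal.ofReal ((1 - ε) / (1 + ε)) * knnRadius (k + 1) X p)
    (f : E → F) (hf : ∀ p ∈ X, ∀ q ∈ X, p ≠ q →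
      (1 - ε) * dist p q < dist (f p) (f q) ∧ dist (f p) (f q) < (1 + ε) * dist p q) :
    IsKnnGraphIso k (X : Set E) f := by
  classical
  have hinj : Set.InjOn f (X : Set E) := by
    intro p hp q hq hpq
    by_contra hne
    have h1 := (hf p hp q hq hne).1
    rw [hpq, dist_self] at h1
    have h2 : 0 < dist p q := dist_pos.2 hne
    nlinarith
  have key : ∀ p ∈ X, ∀ q ∈ X,
      IsNearestNeighbor k (X : Set E) p q ↔
        IsNearestNeighbor k (f '' (X : Set E)) (f p) (f q) := by
    intro p hp q hq
    obtain ⟨Y, hYX, hpY, hcard, hsep⟩ := exists_separated_of_knnRadius hε0 hε1 (hX p hp)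
    have hYinj : Set.InjOn f (Y : Set E) := hinj.mono fun y hy => hYX y hy
    have hmem : ∀ z ∈ X, f z ∈ Y.image f ↔ z ∈ Y := by
      intro z hz
      refine ⟨fun h => ?_, fun h => Finset.mem_image_of_mem f h⟩
      obtain ⟨w, hw, hwz⟩ := Finset.mem_image.1 h
      exact hinj (hYX w hw) hz hwz ▸ hw
    rw [isNearestNeighbor_iff_mem hYX hpY hcard,
      isNearestNeighbor_iff_mem (Y := Y.image f), hmem q hq]
    · intro y hy
      obtain ⟨w, hw, rfl⟩ := Finset.mem_image.1 hy
      exact ⟨w, hYX w hw, rfl⟩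
    · rwa [hmem p hp]
    · exact Finset.card_image_le.trans hcard
    · rintro _ ⟨z, hz, rfl⟩ hzp hzY
      rw [hmem z hz] at hzY
      have hzp' : z ≠ p := fun h => hzp (h ▸ rfl)
      obtain ⟨h1, h2⟩ := hsep z hz hzp' hzY
      refine ⟨by rwa [Finset.card_image_of_injOn hYinj], ?_⟩
      intro y hy
      obtain ⟨w, hw, rfl⟩ := Finset.mem_image.1 hy
      have hwp : p ≠ w := fun h => hpY (h ▸ hw)
      have h3 := (hf p hp w (hYX w hw) hwp).2
      have h4 := (hf p hp z hz hzp'.symm).1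
      linarith [h2 w hw]
    · intro z hz hzp hzY
      obtain ⟨h1, h2⟩ := hsep z hz hzp hzY
      refine ⟨h1, fun y hy => ?_⟩
      have h3 : 0 < dist p y := dist_pos.2 fun h => hpY (h ▸ hy)
      have h4 : 0 < dist p z := dist_pos.2 hzp.symm
      nlinarith [h2 y hy]
  refine ⟨⟨Equiv.Set.imageOfInjOn f (X : Set E) hinj, ?_⟩, fun x => rfl⟩
  intro p q
  exact or_congr (key p p.2 q q.2).symm (key q q.2 p p.2).symm

/-! ### Deterministic analysis of gradient descent -/

theorem abs_dotProduct_le {n : ℕ} (w : Fin n → ℝ) (v : EuclideanSpace ℝ (Fin n)) :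
    |w ⬝ᵥ v.ofLp| ≤ ‖(WithLp.toLp 2 w : EuclideanSpace ℝ (Fin n))‖ * ‖v‖ := by
  have h := abs_real_inner_le_norm v (WithLp.toLp 2 w : EuclideanSpace ℝ (Fin n))
  rw [EuclideanSpace.inner_eq_star_dotProduct] at h
  rw [mul_comm]
  simpa using h

theorem linearLayer_apply {m n : ℕ} (W : Matrix (Fin m) (Fin n) ℝ)
    (v : EuclideanSpace ℝ (Fin n)) (r : Fin m) :
    linearLayer W v r = (Real.sqrt m)⁻¹ * (W r ⬝ᵥ v.ofLp) := rfl

theorem reluDeriv_pos_mul {c : ℝ} (hc : 0 < c) (z : ℝ) : reluDeriv (c * z) = reluDeriv z := by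
  simp [reluDeriv, mul_nonneg_iff_of_pos_left hc]

theorem relu_pos_mul {c : ℝ} (hc : 0 < c) (z : ℝ) : relu (c * z) = c * relu z := by
  simp [relu, mul_max_of_nonneg _ _ hc.le]

theorem abs_reluDeriv_le_one (z : ℝ) : |reluDeriv z| ≤ 1 := by
  unfold reluDeriv; split_ifs <;> simp

/-- The indicator of `|z| ≤ R`: it is `1` when a perturbation of `z` of size `R` may cross the kink
of the activation. -/
noncomputable def nearKink (R z : ℝ) : ℝ := if |z| ≤ R then 1 else 0

theorem nearKink_nonneg (R z : ℝ) : 0 ≤ nearKink R z := by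
  unfold nearKink; split_ifs <;> simp

theorem abs_reluDeriv_sub_le_nearKink {R g₀ g : ℝ} (h : |g - g₀| ≤ R) :
    |reluDeriv g - reluDeriv g₀| ≤ nearKink R g₀ := by
  unfold reluDeriv nearKink
  rw [abs_le] at h
  split_ifs with h1 h2 h3 h3 h3 h3 h4 <;> simp
  · rw [abs_of_neg (by linarith)] at h3; linarith
  · rw [abs_of_nonneg (by linarith)] at h3; linarith

/-- The increment of the activation is linear with the initial slope, unless the initial
preactivation `g₀` is near the kink. -/
theorem abs_relu_sub_sub_le_nearKink {R g₀ g g' : ℝ} (h : |g - g₀| ≤ R) (h' : |g' - g₀| ≤ R) :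
    |relu g' - relu g - reluDeriv g₀ * (g' - g)| ≤ nearKink R g₀ * |g' - g| := by
  unfold nearKink
  rw [abs_le] at h h'
  split_ifs with h0
  · have h1 : 0 ≤ reluDeriv g₀ := by unfold reluDeriv; split_ifs <;> simp
    have h2 := (abs_le.1 (abs_reluDeriv_le_one g₀)).2
    have h3 : |relu g' - relu g - reluDeriv g₀ * (g' - g)| ≤ |g' - g| := by
      unfold relu
      rcases max_cases 0 g with ⟨e, _⟩ | ⟨e, _⟩ <;> rcases max_cases 0 g' with ⟨e', _⟩ | ⟨e', _⟩ <;>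
        rw [e, e'] <;> rcases abs_cases (g' - g) with ⟨e2, _⟩ | ⟨e2, _⟩ <;> rw [e2, abs_le] <;>
        constructor <;> nlinarith
    linarith
  · rw [not_le] at h0
    rcases lt_or_ge g₀ 0 with hg | hg
    · rw [abs_of_neg hg] at h0
      simp [relu, reluDeriv, not_le.2 hg, max_eq_left (show g' ≤ 0 by linarith),
        max_eq_left (show g ≤ 0 by linarith)]
    · rw [abs_of_nonneg hg] at h0
      simp [relu, reluDeriv, hg, max_eq_right (show 0 ≤ g' by linarith),
        max_eq_right (show 0 ≤ g by linarith)]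

/-- The Gram matrix of the network at the weights `W`: the empirical counterpart, over the `m`
rows of `W`, of `gramMatrix`. -/
noncomputable def empiricalGram {m n N : ℕ} (x : Fin N → EuclideanSpace ℝ (Fin n))
    (W : Matrix (Fin m) (Fin n) ℝ) (i j : Fin N) : ℝ :=
  (m : ℝ)⁻¹ * ∑ r, (x i).ofLp ⬝ᵥ (x j).ofLp *
    (reluDeriv (W r ⬝ᵥ (x i).ofLp) * reluDeriv (W r ⬝ᵥ (x j).ofLp))

theorem network_eq {m n : ℕ} (hm : 0 < m) (a : Fin m → ℝ) (W : Matrix (Fin m) (Fin n) ℝ)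
    (v : EuclideanSpace ℝ (Fin n)) :
    network a W v = (Real.sqrt m)⁻¹ * ∑ r, a r * relu (W r ⬝ᵥ v.ofLp) := by
  have hc : 0 < (Real.sqrt m)⁻¹ := by positivity
  unfold network
  rw [Finset.mul_sum]
  refine Finset.sum_congr rfl fun r _ => ?_
  rw [linearLayer_apply, relu_pos_mul hc]
  ring

theorem lossGrad_row {m n N : ℕ} (hm : 0 < m) (x : Fin N → EuclideanSpace ℝ (Fin n))
    (y : EuclideanSpace ℝ (Fin N)) (a : Fin m → ℝ) (W : Matrix (Fin m) (Fin n) ℝ) (r : Fin m) :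
    lossGrad x y a W r = ∑ j, ((predictions x a W - y) j *
      (a r * reluDeriv (W r ⬝ᵥ (x j).ofLp) * (Real.sqrt m)⁻¹)) • (x j).ofLp := by
  have hc : 0 < (Real.sqrt m)⁻¹ := by positivity
  funext k
  simp only [lossGrad, Matrix.of_apply, Finset.sum_apply, Pi.smul_apply, smul_eq_mul,
    linearLayer_apply, reluDeriv_pos_mul hc]
  refine Finset.sum_congr rfl fun j _ => ?_
  simp only [predictions, PiLp.sub_apply]
  ring

theorem sum_abs_le_sqrt_mul_norm {N : ℕ} (z : EuclideanSpace ℝ (Fin N)) :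
    ∑ j, |z j| ≤ Real.sqrt N * ‖z‖ := by
  rw [EuclideanSpace.norm_eq, ← Real.sqrt_mul (Nat.cast_nonneg N)]
  refine Real.le_sqrt_of_sq_le ?_
  simpa using sq_sum_le_card_mul_sum_sq (s := Finset.univ) (f := fun j => |z j|)

theorem norm_lossGrad_row_le {m n N : ℕ} (hm : 0 < m) {x : Fin N → EuclideanSpace ℝ (Fin n)}
    (hx : ∀ i, ‖x i‖ = 1) (y : EuclideanSpace ℝ (Fin N)) {a : Fin m → ℝ} (ha : ∀ r, |a r| = 1)
    (W : Matrix (Fin m) (Fin n) ℝ) (r : Fin m) :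
    ‖(WithLp.toLp 2 (lossGrad x y a W r) : EuclideanSpace ℝ (Fin n))‖
      ≤ (Real.sqrt m)⁻¹ * (Real.sqrt N * ‖predictions x a W - y‖) := by
  have hc : 0 < (Real.sqrt m)⁻¹ := by positivity
  rw [lossGrad_row hm, WithLp.toLp_sum]
  refine (norm_sum_le _ _).trans ?_
  refine le_trans ?_ (mul_le_mul_of_nonneg_left (sum_abs_le_sqrt_mul_norm _) hc.le)
  rw [Finset.mul_sum]
  refine Finset.sum_le_sum fun j _ => ?_
  rw [WithLp.toLp_smul, norm_smul, WithLp.toLp_ofLp, hx j, Real.norm_eq_abs, abs_mul, abs_mul,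
    abs_mul, ha r, abs_of_pos hc]
  have h1 := abs_reluDeriv_le_one (W r ⬝ᵥ (x j).ofLp)
  have h2 := abs_nonneg ((predictions x a W - y) j)
  have h3 : |(predictions x a W - y) j| * |reluDeriv (W r ⬝ᵥ (x j).ofLp)|
      ≤ |(predictions x a W - y) j| * 1 := by gcongr
  nlinarith

theorem abs_dotProduct_unit_le_one {n : ℕ} {u v : EuclideanSpace ℝ (Fin n)} (hu : ‖u‖ = 1)
    (hv : ‖v‖ = 1) : |u.ofLp ⬝ᵥ v.ofLp| ≤ 1 := by
  simpa [hu, hv] using abs_dotProduct_le u.ofLp v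

/-- One gradient step changes the predictions by `-η H z`, up to an error controlled by the number
of neurons near a kink; here `H` is the empirical Gram matrix at the reference weights `W₀` and `z`
is the vector of residuals at `W`. -/
theorem abs_predictions_step_add_le {m n N : ℕ} (hm : 0 < m)
    {x : Fin N → EuclideanSpace ℝ (Fin n)} (hx : ∀ i, ‖x i‖ = 1) (y : EuclideanSpace ℝ (Fin N))
    {a : Fin m → ℝ} (ha : ∀ r, |a r| = 1) {η R : ℝ} (hη : 0 ≤ η)
    {W₀ W W' : Matrix (Fin m) (Fin n) ℝ} (hW' : W' = W - η • lossGrad x y a W)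
    (hW : ∀ r i, |W r ⬝ᵥ (x i).ofLp - W₀ r ⬝ᵥ (x i).ofLp| ≤ R)
    (hWR : ∀ r i, |W' r ⬝ᵥ (x i).ofLp - W₀ r ⬝ᵥ (x i).ofLp| ≤ R)
    {z : EuclideanSpace ℝ (Fin N)} (hz : z = predictions x a W - y) (i : Fin N) :
    |predictions x a W' i - predictions x a W i + η * ∑ j, empiricalGram x W₀ i j * z j|
      ≤ η * (m : ℝ)⁻¹ * ((∑ r, nearKink R (W₀ r ⬝ᵥ (x i).ofLp)) * ∑ j, |z j|
        + ∑ j, |z j| * ∑ r, nearKink R (W₀ r ⬝ᵥ (x j).ofLp)) := by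
  set c := (Real.sqrt m)⁻¹ with hc_def
  have hc : 0 < c := by positivity
  have hcc : c * c = (m : ℝ)⁻¹ := by
    rw [hc_def, ← mul_inv, Real.mul_self_sqrt (Nat.cast_nonneg m)]
  set g : Fin m → Fin N → ℝ := fun r j => W r ⬝ᵥ (x j).ofLp with hg
  set g₀ : Fin m → Fin N → ℝ := fun r j => W₀ r ⬝ᵥ (x j).ofLp with hg0
  set p : Fin N → ℝ := fun j => (x i).ofLp ⬝ᵥ (x j).ofLp with hp
  have hp1 : ∀ j, |p j| ≤ 1 := fun j => abs_dotProduct_unit_le_one (hx i) (hx j)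
  -- the increment of the preactivation of neuron `r` at the data point `i`
  have hΔ : ∀ r, W' r ⬝ᵥ (x i).ofLp - g r i
      = -(η * c * a r * ∑ j, z j * reluDeriv (g r j) * p j) := by
    intro r
    have h1 : W' r = W r - η • lossGrad x y a W r := by rw [hW']; rfl
    rw [h1, sub_dotProduct, smul_dotProduct, lossGrad_row hm, sum_dotProduct, ← hz]
    simp only [smul_dotProduct, smul_eq_mul, hg, Finset.mul_sum, hp]
    rw [sub_sub_cancel_left]
    congr 1
    refine Finset.sum_congr rfl fun j _ => ?_
    rw [dotProduct_comm (x j).ofLp]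
    ring
  -- per neuron, the first error is the nonlinearity of the activation, the second the change of the
  -- activation pattern at the other data points between `W₀` and `W`
  have hmain : predictions x a W' i - predictions x a W i + η * ∑ j, empiricalGram x W₀ i j * z j
      = ∑ r, c * (a r * (relu (W' r ⬝ᵥ (x i).ofLp) - relu (g r i)
            - reluDeriv (g₀ r i) * (W' r ⬝ᵥ (x i).ofLp - g r i))
          - reluDeriv (g₀ r i) * (η * c * ∑ j, z j * (reluDeriv (g r j) - reluDeriv (g₀ r j))
            * p j)) := by
    have h1 : ∑ j, empiricalGram x W₀ i j * z j
        = ∑ r, c * (c * (reluDeriv (g₀ r i) * ∑ j, z j * reluDeriv (g₀ r j) * p j)) := by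
      simp only [empiricalGram, Finset.mul_sum, Finset.sum_mul]
      rw [Finset.sum_comm]
      refine Finset.sum_congr rfl fun r _ => Finset.sum_congr rfl fun j _ => ?_
      rw [← hcc]
      ring
    simp only [predictions, network_eq hm, ← hc_def]
    rw [h1, ← mul_sub, ← Finset.sum_sub_distrib, Finset.mul_sum, Finset.mul_sum,
      ← Finset.sum_add_distrib]
    refine Finset.sum_congr rfl fun r _ => ?_
    have h2 : ∑ j, z j * (reluDeriv (g r j) - reluDeriv (g₀ r j)) * p j
        = ∑ j, z j * reluDeriv (g r j) * p j - ∑ j, z j * reluDeriv (g₀ r j) * p j := by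
      rw [← Finset.sum_sub_distrib]
      exact Finset.sum_congr rfl fun j _ => by ring
    have haa : a r * a r = 1 := by rw [← abs_mul_abs_self, ha r, one_mul]
    rw [h2, hΔ r]
    simp only [hg]
    linear_combination (-(c * reluDeriv (g₀ r i) * η * c *
      ∑ j, z j * reluDeriv (W r ⬝ᵥ (x j).ofLp) * p j)) * haa
  rw [hmain]
  refine (Finset.abs_sum_le_sum_abs _ _).trans ?_
  have hr : ∀ r, |c * (a r * (relu (W' r ⬝ᵥ (x i).ofLp) - relu (g r i)
            - reluDeriv (g₀ r i) * (W' r ⬝ᵥ (x i).ofLp - g r i))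
          - reluDeriv (g₀ r i) * (η * c * ∑ j, z j * (reluDeriv (g r j) - reluDeriv (g₀ r j))
            * p j))|
      ≤ η * (m : ℝ)⁻¹ * (nearKink R (g₀ r i) * ∑ j, |z j|
        + ∑ j, |z j| * nearKink R (g₀ r j)) := by
    intro r
    have h1 : |W' r ⬝ᵥ (x i).ofLp - g r i| ≤ η * c * ∑ j, |z j| := by
      rw [hΔ r, abs_neg, abs_mul, abs_mul, ha r, mul_one, abs_of_nonneg (by positivity : 0 ≤ η * c)]
      refine mul_le_mul_of_nonneg_left ((Finset.abs_sum_le_sum_abs _ _).trans ?_) (by positivity)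
      refine Finset.sum_le_sum fun j _ => ?_
      rw [abs_mul, abs_mul, mul_assoc]
      exact mul_le_of_le_one_right (abs_nonneg _)
        (mul_le_one₀ (abs_reluDeriv_le_one _) (abs_nonneg _) (hp1 j))
    have h2 : |∑ j, z j * (reluDeriv (g r j) - reluDeriv (g₀ r j)) * p j|
        ≤ ∑ j, |z j| * nearKink R (g₀ r j) := by
      refine (Finset.abs_sum_le_sum_abs _ _).trans (Finset.sum_le_sum fun j _ => ?_)
      rw [abs_mul, abs_mul]
      have h3 := abs_reluDeriv_sub_le_nearKink (hW r j)
      calc |z j| * |reluDeriv (g r j) - reluDeriv (g₀ r j)| * |p j|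
          ≤ |z j| * |reluDeriv (g r j) - reluDeriv (g₀ r j)| :=
            mul_le_of_le_one_right (by positivity) (hp1 j)
        _ ≤ |z j| * nearKink R (g₀ r j) := by gcongr
    have h3 := abs_relu_sub_sub_le_nearKink (hW r i) (hWR r i)
    have h4 : |a r * (relu (W' r ⬝ᵥ (x i).ofLp) - relu (g r i)
            - reluDeriv (g₀ r i) * (W' r ⬝ᵥ (x i).ofLp - g r i))|
        ≤ nearKink R (g₀ r i) * (η * c * ∑ j, |z j|) := by
      rw [abs_mul, ha r, one_mul]
      exact h3.trans (mul_le_mul_of_nonneg_left h1 (nearKink_nonneg _ _))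
    have h5 : |reluDeriv (g₀ r i) * (η * c * ∑ j, z j * (reluDeriv (g r j) - reluDeriv (g₀ r j))
            * p j)| ≤ η * c * ∑ j, |z j| * nearKink R (g₀ r j) := by
      rw [abs_mul, abs_mul, abs_of_nonneg (by positivity : 0 ≤ η * c)]
      refine (mul_le_of_le_one_left (by positivity) (abs_reluDeriv_le_one _)).trans ?_
      gcongr
    rw [abs_mul, abs_of_pos hc, ← hcc]
    refine (mul_le_mul_of_nonneg_left ((abs_sub _ _).trans (add_le_add h4 h5)) hc.le).trans ?_
    apply le_of_eq
    ring
  refine (Finset.sum_le_sum fun r _ => hr r).trans (le_of_eq ?_)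
  rw [← Finset.mul_sum, Finset.sum_add_distrib, ← Finset.sum_mul, Finset.sum_comm]
  simp only [Finset.mul_sum, hg0]

theorem norm_le_sum_abs {N : ℕ} (z : EuclideanSpace ℝ (Fin N)) : ‖z‖ ≤ ∑ i, |z i| := by
  rw [EuclideanSpace.norm_eq]
  refine Real.sqrt_le_iff.2 ⟨Finset.sum_nonneg fun _ _ => abs_nonneg _, ?_⟩
  simpa using Finset.sum_sq_le_sq_sum_of_nonneg (s := Finset.univ) (f := fun i => |z i|)
    fun i _ => abs_nonneg _

theorem abs_empiricalGram_le_one {m n N : ℕ} (hm : 0 < m) {x : Fin N → EuclideanSpace ℝ (Fin n)}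
    (hx : ∀ i, ‖x i‖ = 1) (W : Matrix (Fin m) (Fin n) ℝ) (i j : Fin N) :
    |empiricalGram x W i j| ≤ 1 := by
  have hm' : (0 : ℝ) < m := by exact_mod_cast hm
  unfold empiricalGram
  rw [abs_mul, abs_of_pos (inv_pos.2 hm'), inv_mul_le_iff₀ hm', mul_one]
  refine (Finset.abs_sum_le_sum_abs _ _).trans ?_
  refine (Finset.sum_le_card_nsmul _ _ 1 fun r _ => ?_).trans (by simp)
  rw [abs_mul, abs_mul]
  exact mul_le_one₀ (abs_dotProduct_unit_le_one (hx i) (hx j)) (by positivity)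
    (mul_le_one₀ (abs_reluDeriv_le_one _) (abs_nonneg _) (abs_reluDeriv_le_one _))

/-- A step `z ↦ z - η H z` contracts, when the quadratic form of `H` is at least `3λ/4` and the
step size is small. -/
theorem norm_sub_smul_le {N : ℕ} {H : Fin N → Fin N → ℝ} {lam η : ℝ} (hη : 0 < η)
    (hlam1 : lam ≤ 1) (hN : 0 < N) (hηN : η * (N : ℝ) ^ 2 ≤ lam / 10)
    (hH1 : ∀ i j, |H i j| ≤ 1) (z : EuclideanSpace ℝ (Fin N))
    (hH : 3 / 4 * lam * ‖z‖ ^ 2 ≤ ∑ i, ∑ j, z i * H i j * z j) :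
    ‖z - η • (WithLp.toLp 2 fun i => ∑ j, H i j * z j : EuclideanSpace ℝ (Fin N))‖
      ≤ (1 - 7 / 10 * (η * lam)) * ‖z‖ := by
  set v : EuclideanSpace ℝ (Fin N) := WithLp.toLp 2 fun i => ∑ j, H i j * z j with hv
  have hN' : (1 : ℝ) ≤ N := by exact_mod_cast hN
  have hη10 : η ≤ 1 / 10 := by nlinarith [mul_le_mul_of_nonneg_left (one_le_pow₀ hN' (n := 2)) hη.le]
  have hηlam : η * lam ≤ 1 / 10 := by nlinarith
  have hinner : inner ℝ z v = ∑ i, ∑ j, z i * H i j * z j := by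
    simp only [PiLp.inner_apply, hv, RCLike.inner_apply, conj_trivial, Finset.sum_mul]
    exact Finset.sum_congr rfl fun i _ => Finset.sum_congr rfl fun j _ => by ring
  have hvN : ‖v‖ ≤ N * ‖z‖ := by
    have hs : ∀ i, ‖v i‖ ^ 2 ≤ (Real.sqrt N * ‖z‖) ^ 2 := fun i => by
      refine pow_le_pow_left₀ (norm_nonneg _) (le_trans ?_ (sum_abs_le_sqrt_mul_norm z)) 2
      change |∑ j, H i j * z j| ≤ _
      refine (Finset.abs_sum_le_sum_abs _ _).trans ?_
      refine Finset.sum_le_sum fun j _ => ?_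
      rw [abs_mul]
      exact mul_le_of_le_one_left (abs_nonneg _) (hH1 i j)
    rw [EuclideanSpace.norm_eq]
    refine Real.sqrt_le_iff.2 ⟨by positivity, ?_⟩
    refine (Finset.sum_le_card_nsmul _ _ _ fun i _ => hs i).trans (le_of_eq ?_)
    rw [Finset.card_univ, Fintype.card_fin, nsmul_eq_mul, mul_pow, Real.sq_sqrt (by positivity)]
    ring
  have hsq : ‖z - η • v‖ ^ 2 ≤ ((1 - 7 / 10 * (η * lam)) * ‖z‖) ^ 2 := by
    rw [norm_sub_sq_real, inner_smul_right, hinner, norm_smul, Real.norm_eq_abs, abs_of_pos hη]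
    have h1 : (η * ‖v‖) ^ 2 ≤ η * (lam / 10) * ‖z‖ ^ 2 := by
      calc (η * ‖v‖) ^ 2 ≤ (η * (N * ‖z‖)) ^ 2 := by gcongr
        _ = η * (η * (N : ℝ) ^ 2) * ‖z‖ ^ 2 := by ring
        _ ≤ _ := by gcongr
    nlinarith [mul_le_mul_of_nonneg_left hH hη.le, sq_nonneg (η * lam * ‖z‖)]
  exact (pow_le_pow_iff_left₀ (norm_nonneg _) (mul_nonneg (by linarith) (norm_nonneg z))
    two_ne_zero).1 hsq

/-- One gradient step contracts the residuals by `1 - η λ / 4`, as long as the weights stay within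
the reference radius `R` of `W₀` and few neurons are within `R` of a kink at `W₀`. -/
theorem norm_residual_step_le {m n N : ℕ} (hm : 0 < m) (hN : 0 < N)
    {x : Fin N → EuclideanSpace ℝ (Fin n)} (hx : ∀ i, ‖x i‖ = 1) (y : EuclideanSpace ℝ (Fin N))
    {a : Fin m → ℝ} (ha : ∀ r, |a r| = 1) {η R lam : ℝ} (hη : 0 < η) (hlam : 0 < lam)
    (hlam1 : lam ≤ 1) (hηN : η * (N : ℝ) ^ 2 ≤ lam / 10) {W₀ W W' : Matrix (Fin m) (Fin n) ℝ}
    (hH : ∀ z : EuclideanSpace ℝ (Fin N),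
      3 / 4 * lam * ‖z‖ ^ 2 ≤ ∑ i, ∑ j, z i * empiricalGram x W₀ i j * z j)
    (hB : 2 * N * ∑ i, ∑ r, nearKink R (W₀ r ⬝ᵥ (x i).ofLp) ≤ m * (lam / 8))
    (hW' : W' = W - η • lossGrad x y a W)
    (hW : ∀ r i, |W r ⬝ᵥ (x i).ofLp - W₀ r ⬝ᵥ (x i).ofLp| ≤ R)
    (hWR : ∀ r i, |W' r ⬝ᵥ (x i).ofLp - W₀ r ⬝ᵥ (x i).ofLp| ≤ R) :
    ‖predictions x a W' - y‖ ≤ (1 - η * lam / 4) * ‖predictions x a W - y‖ := by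
  have hm' : (0 : ℝ) < m := by exact_mod_cast hm
  set z := predictions x a W - y with hz
  set T : Fin N → ℝ := fun i => ∑ r, nearKink R (W₀ r ⬝ᵥ (x i).ofLp) with hT
  have hT0 : ∀ i, 0 ≤ T i := fun i => Finset.sum_nonneg fun r _ => nearKink_nonneg _ _
  set v : EuclideanSpace ℝ (Fin N) :=
    WithLp.toLp 2 fun i => ∑ j, empiricalGram x W₀ i j * z j with hv
  -- the deviation of the step from its linearization `z ↦ z - η H z`
  set e : EuclideanSpace ℝ (Fin N) := predictions x a W' - predictions x a W + η • v with he
  have hdecomp : predictions x a W' - y = (z - η • v) + e := by rw [he, hz]; abel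
  have hzi : ∀ j, |z j| ≤ ‖z‖ := fun j => by simpa using PiLp.norm_apply_le z j
  have hz1 : ∑ j, |z j| ≤ N * ‖z‖ := by
    simpa using Finset.sum_le_card_nsmul Finset.univ (fun j => |z j|) ‖z‖ fun j _ => hzi j
  have hzT : ∑ j, |z j| * T j ≤ ‖z‖ * ∑ j, T j := by
    rw [Finset.mul_sum]
    exact Finset.sum_le_sum fun j _ => mul_le_mul_of_nonneg_right (hzi j) (hT0 j)
  have hei : ∀ i, |e i| ≤ η * (m : ℝ)⁻¹ * (T i * (N * ‖z‖) + ‖z‖ * ∑ j, T j) := fun i => by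
    refine (abs_predictions_step_add_le hm hx y ha hη.le hW' hW hWR hz i).trans ?_
    refine mul_le_mul_of_nonneg_left (add_le_add ?_ hzT) (by positivity)
    exact mul_le_mul_of_nonneg_left hz1 (hT0 i)
  have henorm : ‖e‖ ≤ 1 / 8 * (η * lam) * ‖z‖ := by
    refine (norm_le_sum_abs e).trans ((Finset.sum_le_sum fun i _ => hei i).trans ?_)
    rw [← Finset.mul_sum, Finset.sum_add_distrib, ← Finset.sum_mul, Finset.sum_const,
      Finset.card_univ, Fintype.card_fin, nsmul_eq_mul]
    calc η * (m : ℝ)⁻¹ * ((∑ i, T i) * (N * ‖z‖) + N * (‖z‖ * ∑ j, T j))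
        = η * (m : ℝ)⁻¹ * (2 * N * ∑ i, T i) * ‖z‖ := by ring
      _ ≤ η * (m : ℝ)⁻¹ * (m * (lam / 8)) * ‖z‖ := by gcongr
      _ = 1 / 8 * (η * lam) * ‖z‖ := by field_simp
  have hmain := norm_sub_smul_le hη hlam1 hN hηN
    (fun i j => abs_empiricalGram_le_one hm hx W₀ i j) z (hH z)
  rw [hdecomp]
  refine (norm_add_le _ _).trans ?_
  nlinarith [mul_nonneg (mul_nonneg hη.le hlam.le) (norm_nonneg z)]

/-- Gradient descent from a good initialization never leaves the ball of radius
`4 √N ‖u(0) - y‖ / (√m λ)`, row by row: the residuals decay geometrically, so that the lengths of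
the steps sum to at most this radius, within which the activation patterns hardly change. -/
theorem norm_gdWeights_sub_le {m n N : ℕ} (hm : 0 < m) (hN : 0 < N)
    {x : Fin N → EuclideanSpace ℝ (Fin n)} (hx : ∀ i, ‖x i‖ = 1) (y : EuclideanSpace ℝ (Fin N))
    {a : Fin m → ℝ} (ha : ∀ r, |a r| = 1) {η R lam : ℝ} (hη : 0 < η) (hlam : 0 < lam)
    (hlam1 : lam ≤ 1) (hηN : η * (N : ℝ) ^ 2 ≤ lam / 10) {W₀ : Matrix (Fin m) (Fin n) ℝ}
    (hH : ∀ z : EuclideanSpace ℝ (Fin N),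
      3 / 4 * lam * ‖z‖ ^ 2 ≤ ∑ i, ∑ j, z i * empiricalGram x W₀ i j * z j)
    (hB : 2 * N * ∑ i, ∑ r, nearKink R (W₀ r ⬝ᵥ (x i).ofLp) ≤ m * (lam / 8))
    (hR : 4 * Real.sqrt N * ‖predictions x a W₀ - y‖ / (Real.sqrt m * lam) ≤ R)
    (l : ℕ) (r : Fin m) :
    ‖(WithLp.toLp 2 (gdWeights x y η a W₀ l r - W₀ r) : EuclideanSpace ℝ (Fin n))‖
      ≤ 4 * Real.sqrt N * ‖predictions x a W₀ - y‖ / (Real.sqrt m * lam) := by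
  set D := 4 * Real.sqrt N * ‖predictions x a W₀ - y‖ / (Real.sqrt m * lam) with hD
  have hm' : (0 : ℝ) < m := by exact_mod_cast hm
  have hN' : (1 : ℝ) ≤ N := by exact_mod_cast hN
  have hsm : 0 < Real.sqrt m := Real.sqrt_pos.2 hm'
  have hD0 : 0 ≤ D := by positivity
  have hη10 : η ≤ 1 / 10 := by nlinarith [mul_le_mul_of_nonneg_left (one_le_pow₀ hN' (n := 2)) hη.le]
  set ρ := 1 - η * lam / 4 with hρ
  have hρ0 : 0 ≤ ρ := by nlinarith
  have hclose : ∀ W : Matrix (Fin m) (Fin n) ℝ, (∀ r,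
      ‖(WithLp.toLp 2 (W r - W₀ r) : EuclideanSpace ℝ (Fin n))‖ ≤ D) →
      ∀ r i, |W r ⬝ᵥ (x i).ofLp - W₀ r ⬝ᵥ (x i).ofLp| ≤ R := by
    intro W hW r i
    rw [← sub_dotProduct]
    have h1 := abs_dotProduct_le (W r - W₀ r) (x i)
    rw [hx i, mul_one] at h1
    exact h1.trans ((hW r).trans hR)
  -- the total length of the first `l` steps is at most `D (1 - ρ ^ l)`
  have key : ∀ l, (∀ r, ‖(WithLp.toLp 2 (gdWeights x y η a W₀ l r - W₀ r) :
        EuclideanSpace ℝ (Fin n))‖ ≤ D * (1 - ρ ^ l)) ∧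
      ‖predictions x a (gdWeights x y η a W₀ l) - y‖ ≤ ρ ^ l * ‖predictions x a W₀ - y‖ := by
    intro l
    induction l with
    | zero => simp [gdWeights]
    | succ l ih =>
      obtain ⟨ih1, ih2⟩ := ih
      have hstep : ∀ r, ‖(WithLp.toLp 2 (gdWeights x y η a W₀ (l + 1) r - W₀ r) :
          EuclideanSpace ℝ (Fin n))‖ ≤ D * (1 - ρ ^ (l + 1)) := by
        intro r
        have h1 : gdWeights x y η a W₀ (l + 1) r - W₀ r = (gdWeights x y η a W₀ l r - W₀ r)
            - η • lossGrad x y a (gdWeights x y η a W₀ l) r := by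
          change (gdWeights x y η a W₀ l r - η • lossGrad x y a (gdWeights x y η a W₀ l) r)
            - W₀ r = _
          abel
        rw [h1, WithLp.toLp_sub, WithLp.toLp_smul]
        refine (norm_sub_le _ _).trans ?_
        rw [norm_smul, Real.norm_eq_abs, abs_of_pos hη]
        have h2 : η * ‖(WithLp.toLp 2 (lossGrad x y a (gdWeights x y η a W₀ l) r) :
            EuclideanSpace ℝ (Fin n))‖ ≤ D * (ρ ^ l - ρ ^ (l + 1)) := by
          calc _ ≤ η * ((Real.sqrt m)⁻¹ * (Real.sqrt N *
                (ρ ^ l * ‖predictions x a W₀ - y‖))) := by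
                gcongr
                refine (norm_lossGrad_row_le hm hx y ha _ r).trans ?_
                gcongr
            _ = D * (ρ ^ l - ρ ^ (l + 1)) := by
                rw [pow_succ, hD, hρ]
                field_simp
                ring
        linarith [ih1 r]
      have hle : ∀ j : ℕ, D * (1 - ρ ^ j) ≤ D := fun j => by
        nlinarith [mul_nonneg hD0 (pow_nonneg hρ0 j)]
      refine ⟨hstep, ?_⟩
      refine (norm_residual_step_le hm hN hx y ha hη hlam hlam1 hηN hH hB rfl
        (hclose _ fun r => (ih1 r).trans (hle l))
        (hclose _ fun r => (hstep r).trans (hle (l + 1)))).trans ?_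
      rw [pow_succ, mul_comm (ρ ^ l), mul_assoc]
      exact mul_le_mul_of_nonneg_left ih2 hρ0
  refine ((key l).1 r).trans ?_
  nlinarith [mul_nonneg hD0 (pow_nonneg hρ0 l)]

theorem linearLayer_sub_apply {m n : ℕ} (W : Matrix (Fin m) (Fin n) ℝ)
    (u v : EuclideanSpace ℝ (Fin n)) :
    linearLayer W u - linearLayer W v = linearLayer W (u - v) := by
  ext r
  simp [linearLayer_apply, mul_sub]

/-- Moving each row of the weights by at most `D` moves the scaled layer by at most `D` in operator
norm. -/
theorem norm_linearLayer_sub_le {m n : ℕ} (hm : 0 < m) {W W₀ : Matrix (Fin m) (Fin n) ℝ} {D : ℝ}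
    (hD : 0 ≤ D) (h : ∀ r, ‖(WithLp.toLp 2 (W r - W₀ r) : EuclideanSpace ℝ (Fin n))‖ ≤ D)
    (v : EuclideanSpace ℝ (Fin n)) :
    ‖linearLayer W v - linearLayer W₀ v‖ ≤ D * ‖v‖ := by
  have hm' : (0 : ℝ) < m := by exact_mod_cast hm
  rw [EuclideanSpace.norm_eq]
  refine Real.sqrt_le_iff.2 ⟨by positivity, ?_⟩
  have hr : ∀ r, ‖(linearLayer W v - linearLayer W₀ v) r‖ ^ 2 ≤ (m : ℝ)⁻¹ * (D * ‖v‖) ^ 2 := by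
    intro r
    rw [PiLp.sub_apply, linearLayer_apply, linearLayer_apply, ← mul_sub, ← sub_dotProduct,
      norm_mul, mul_pow, Real.norm_eq_abs, sq_abs, inv_pow, Real.sq_sqrt hm'.le]
    gcongr
    exact (abs_dotProduct_le _ _).trans (by gcongr; exact h r)
  refine (Finset.sum_le_card_nsmul _ _ _ fun r _ => hr r).trans ?_
  rw [Finset.card_univ, Fintype.card_fin, nsmul_eq_mul, mul_inv_cancel_left₀ hm'.ne']

/-! ### Gaussian concentration and the Johnson–Lindenstrauss lemma -/

/-- The law of `n` independent standard normal variables. -/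
noncomputable abbrev gaussianVec (n : ℕ) : Measure (Fin n → ℝ) :=
  Measure.pi fun _ : Fin n => gaussianReal 0 1

theorem measurable_dotProduct {n : ℕ} (v : Fin n → ℝ) :
    Measurable fun w : Fin n → ℝ => w ⬝ᵥ v := by
  unfold dotProduct; fun_prop

theorem map_dotProduct_gaussianVec {n : ℕ} {u : EuclideanSpace ℝ (Fin n)} (hu : ‖u‖ = 1) :
    (gaussianVec n).map (fun w => w ⬝ᵥ u.ofLp) = gaussianReal 0 1 := by
  have h1 : (fun w : Fin n → ℝ => w ⬝ᵥ u.ofLp)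
      = (innerSL ℝ u) ∘ (WithLp.toLp 2 : (Fin n → ℝ) → EuclideanSpace ℝ (Fin n)) := by
    funext w
    simp [EuclideanSpace.inner_eq_star_dotProduct]
  rw [h1, ← Measure.map_map (by fun_prop) (by fun_prop), map_pi_eq_stdGaussian,
    IsGaussian.map_eq_gaussianReal, integral_strongDual_stdGaussian, variance_dual_stdGaussian,
    innerSL_apply_norm, hu]
  simp

theorem measurePreserving_dotProduct {n : ℕ} {u : EuclideanSpace ℝ (Fin n)} (hu : ‖u‖ = 1) :
    MeasurePreserving (fun w => w ⬝ᵥ u.ofLp) (gaussianVec n) (gaussianReal 0 1) :=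
  ⟨measurable_dotProduct _, map_dotProduct_gaussianVec hu⟩

/-- The moment generating function of the square of a standard normal variable. -/
theorem mgf_sq_gaussianReal {s : ℝ} (hs : s < 1 / 2) :
    mgf (fun x : ℝ => x ^ 2) (gaussianReal 0 1) s = (Real.sqrt (1 - 2 * s))⁻¹ := by
  have hpos : 0 < 1 - 2 * s := by linarith
  rw [mgf, integral_gaussianReal_eq_integral_smul one_ne_zero]
  have h1 : ∀ x : ℝ, gaussianPDFReal 0 1 x • Real.exp (s * x ^ 2)
      = (Real.sqrt (2 * Real.pi))⁻¹ * Real.exp (-((1 - 2 * s) / 2) * x ^ 2) := by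
    intro x
    simp only [gaussianPDFReal, NNReal.coe_one, mul_one, sub_zero, smul_eq_mul]
    rw [mul_assoc, ← Real.exp_add]
    congr 2
    ring
  simp_rw [h1]
  rw [integral_const_mul, integral_gaussian, ← Real.sqrt_inv, ← Real.sqrt_inv,
    ← Real.sqrt_mul (by positivity)]
  congr 1
  field_simp

theorem mgf_sum_sq_gaussianVec (m : ℕ) {s : ℝ} (hs : s < 1 / 2) :
    mgf (fun g : Fin m → ℝ => ∑ r, g r ^ 2) (gaussianVec m) s
      = (Real.sqrt (1 - 2 * s))⁻¹ ^ m := by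
  have hind : iIndepFun (fun (r : Fin m) (g : Fin m → ℝ) => g r ^ 2) (gaussianVec m) :=
    iIndepFun_pi (X := fun _ x => x ^ 2) fun _ => by fun_prop
  have h1 := hind.mgf_sum (t := s) (fun r => by fun_prop) Finset.univ
  have h2 : (∑ r : Fin m, fun g : Fin m → ℝ => g r ^ 2) = fun g => ∑ r, g r ^ 2 := by
    funext g; simp
  rw [h2] at h1
  have h3 : ∀ r : Fin m, mgf (fun g : Fin m → ℝ => g r ^ 2) (gaussianVec m) s
      = (Real.sqrt (1 - 2 * s))⁻¹ := by
    intro r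
    rw [← mgf_sq_gaussianReal hs, mgf, mgf,
      ← (measurePreserving_eval (fun _ : Fin m => gaussianReal 0 1) r).map_eq,
      integral_map (φ := Function.eval r) (measurable_pi_apply r).aemeasurable (by fun_prop)]
  rw [h1]
  simp [h3]

/-- Integrability follows from the nonzero value of the moment generating function, because a
divergent integral would have the value `0`. -/
theorem integrable_exp_mul_sum_sq (m : ℕ) {s : ℝ} (hs : s < 1 / 2) :
    Integrable (fun g : Fin m → ℝ => Real.exp (s * ∑ r, g r ^ 2)) (gaussianVec m) := by
  by_contra h
  have h1 := mgf_sum_sq_gaussianVec m hs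
  rw [mgf, integral_undef h] at h1
  have h2 : 0 < Real.sqrt (1 - 2 * s) := Real.sqrt_pos.2 (by linarith)
  exact absurd h1.symm (by positivity)

theorem one_add_le_exp_cubic {t : ℝ} (ht : 0 ≤ t) :
    1 + t ≤ Real.exp (t - t ^ 2 / 2 + t ^ 3 / 2) := by
  have h0 : 0 ≤ t - t ^ 2 / 2 + t ^ 3 / 2 := by
    have : t - t ^ 2 / 2 + t ^ 3 / 2 = t * (1 - t / 2 + t ^ 2 / 2) := by ring
    rw [this]
    exact mul_nonneg ht (by nlinarith [sq_nonneg (t - 1)])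
  refine le_trans ?_ (Real.quadratic_le_exp_of_nonneg h0)
  have h1 : 1 + (t - t ^ 2 / 2 + t ^ 3 / 2) + (t - t ^ 2 / 2 + t ^ 3 / 2) ^ 2 / 2
      = 1 + t + t ^ 4 * (5 - 2 * t + t ^ 2) / 8 := by ring
  rw [h1]
  have : 0 ≤ t ^ 4 * (5 - 2 * t + t ^ 2) / 8 := by
    have : 0 ≤ 5 - 2 * t + t ^ 2 := by nlinarith [sq_nonneg (t - 1)]
    positivity
  linarith

theorem one_sub_le_exp_cubic {t : ℝ} (ht : 0 ≤ t) (ht1 : t < 1) :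
    1 - t ≤ Real.exp (-t - t ^ 2 / 2 + t ^ 3 / 2) := by
  have h := Real.hasSum_pow_div_log_of_abs_lt_one (x := t) (by rwa [abs_of_nonneg ht])
  have h1 := sum_le_hasSum (Finset.range 2) (fun i _ => by positivity) h
  rw [Finset.sum_range_succ, Finset.sum_range_one] at h1
  norm_num at h1
  rw [← Real.log_le_iff_le_exp (by linarith)]
  have : 0 ≤ t ^ 3 := by positivity
  linarith

/-- The parameter `u / (2 (1 + u))` is the optimal one in the Chernoff bound for the probability
that the average of the squares deviates from `1` by `u`. -/
theorem chernoff_sum_sq (m : ℕ) {u B : ℝ} (hu : -1 < u) (hB : 1 + u ≤ Real.exp (u + 2 * B)) :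
    Real.exp (-(u / (2 * (1 + u))) * ((1 + u) * m))
      * (Real.sqrt (1 - 2 * (u / (2 * (1 + u)))))⁻¹ ^ m ≤ Real.exp (m * B) := by
  have hu' : 0 < 1 + u := by linarith
  have h1 : 1 - 2 * (u / (2 * (1 + u))) = (1 + u)⁻¹ := by field_simp; ring
  have h2 : -(u / (2 * (1 + u))) * ((1 + u) * m) = m * (-(u / 2)) := by field_simp
  rw [h1, h2, Real.sqrt_inv, inv_inv, Real.exp_nat_mul, Real.exp_nat_mul, ← mul_pow]
  refine pow_le_pow_left₀ (by positivity) ?_ m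
  have h3 : Real.sqrt (1 + u) ≤ Real.exp (u / 2 + B) := by
    refine Real.sqrt_le_iff.2 ⟨(Real.exp_pos _).le, ?_⟩
    rw [← Real.exp_nat_mul]
    refine hB.trans (le_of_eq ?_)
    congr 1
    push_cast
    ring
  calc _ ≤ Real.exp (-(u / 2)) * Real.exp (u / 2 + B) := by gcongr
    _ = Real.exp B := by rw [← Real.exp_add]; congr 1; ring

theorem sum_sq_upper_tail (m : ℕ) {t : ℝ} (ht : 0 ≤ t) :
    (gaussianVec m).real {g | (1 + t) * m ≤ ∑ r, g r ^ 2}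
      ≤ Real.exp (m * ((t ^ 3 - t ^ 2) / 4)) := by
  have hs : t / (2 * (1 + t)) < 1 / 2 := by
    rw [div_lt_div_iff₀ (by linarith) (by norm_num)]; linarith
  refine (measure_ge_le_exp_mul_mgf _ (by positivity) (integrable_exp_mul_sum_sq m hs)).trans ?_
  rw [mgf_sum_sq_gaussianVec m hs]
  refine chernoff_sum_sq m (by linarith) ((one_add_le_exp_cubic ht).trans (le_of_eq ?_))
  congr 1
  ring

theorem sum_sq_lower_tail (m : ℕ) {t : ℝ} (ht : 0 ≤ t) (ht1 : t < 1) :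
    (gaussianVec m).real {g | ∑ r, g r ^ 2 ≤ (1 - t) * m}
      ≤ Real.exp (m * ((t ^ 3 - t ^ 2) / 4)) := by
  have h0 : -t / (2 * (1 + -t)) ≤ 0 :=
    div_nonpos_of_nonpos_of_nonneg (by linarith) (by linarith)
  have hs : -t / (2 * (1 + -t)) < 1 / 2 := by linarith
  refine (measure_le_le_exp_mul_mgf _ h0 (integrable_exp_mul_sum_sq m hs)).trans ?_
  rw [mgf_sum_sq_gaussianVec m hs, sub_eq_add_neg 1 t]
  refine chernoff_sum_sq m (by linarith) ((?_ : 1 + -t = 1 - t).trans_le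
    ((one_sub_le_exp_cubic ht ht1).trans (le_of_eq ?_)))
  · ring
  · congr 1
    ring

/-- The law of the first-layer weights at initialization. -/
noncomputable abbrev weightLaw (m n : ℕ) : Measure (Fin m → Fin n → ℝ) :=
  Measure.pi fun _ : Fin m => gaussianVec n

theorem measurePreserving_rows {m n : ℕ} {u : EuclideanSpace ℝ (Fin n)} (hu : ‖u‖ = 1) :
    MeasurePreserving (fun (W : Fin m → Fin n → ℝ) r => W r ⬝ᵥ u.ofLp) (weightLaw m n)
      (gaussianVec m) :=
  measurePreserving_pi _ _ fun _ => measurePreserving_dotProduct hu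

theorem norm_linearLayer_sq {m n : ℕ} (W : Matrix (Fin m) (Fin n) ℝ)
    (v : EuclideanSpace ℝ (Fin n)) :
    ‖linearLayer W v‖ ^ 2 = (m : ℝ)⁻¹ * ∑ r, (W r ⬝ᵥ v.ofLp) ^ 2 := by
  rw [EuclideanSpace.norm_sq_eq, Finset.mul_sum]
  refine Finset.sum_congr rfl fun r _ => ?_
  rw [linearLayer_apply, norm_mul, mul_pow, Real.norm_eq_abs, Real.norm_eq_abs, sq_abs, sq_abs,
    inv_pow, Real.sq_sqrt (Nat.cast_nonneg m)]

theorem norm_linearLayer_sq_eq_normalized {m n : ℕ} (W : Matrix (Fin m) (Fin n) ℝ)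
    {v : EuclideanSpace ℝ (Fin n)} (hv : v ≠ 0) :
    ‖linearLayer W v‖ ^ 2 = ‖v‖ ^ 2 * ((m : ℝ)⁻¹ * ∑ r, (W r ⬝ᵥ (‖v‖⁻¹ • v).ofLp) ^ 2) := by
  have hv' : ‖v‖ ≠ 0 := norm_ne_zero_iff.2 hv
  rw [norm_linearLayer_sq, Finset.mul_sum, Finset.mul_sum, Finset.mul_sum]
  refine Finset.sum_congr rfl fun r _ => ?_
  rw [WithLp.ofLp_smul, dotProduct_smul, smul_eq_mul]
  field_simp

theorem linearLayer_upper_tail {m n : ℕ} (hm : 0 < m) {t : ℝ} (ht : 0 ≤ t)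
    {v : EuclideanSpace ℝ (Fin n)} (hv : v ≠ 0) :
    (weightLaw m n).real {W | (1 + t) * ‖v‖ ^ 2 ≤ ‖linearLayer (Matrix.of W) v‖ ^ 2}
      ≤ Real.exp (m * ((t ^ 3 - t ^ 2) / 4)) := by
  have hm' : (0 : ℝ) < m := by exact_mod_cast hm
  have hv' : 0 < ‖v‖ ^ 2 := by have := norm_pos_iff.2 hv; positivity
  have hu : ‖(‖v‖⁻¹ • v)‖ = 1 := norm_smul_inv_norm hv
  refine le_trans (le_of_eq ?_) (sum_sq_upper_tail m ht)
  rw [← (measurePreserving_rows (m := m) hu).measureReal_preimage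
    (measurableSet_le (by fun_prop) (by fun_prop)).nullMeasurableSet]
  congr 1
  ext W
  simp only [Set.mem_ofPred_eq, Set.mem_preimage]
  rw [norm_linearLayer_sq_eq_normalized _ hv, mul_comm, mul_le_mul_iff_right₀ hv',
    le_inv_mul_iff₀ hm', mul_comm]
  rfl

theorem linearLayer_lower_tail {m n : ℕ} (hm : 0 < m) {t : ℝ} (ht : 0 ≤ t) (ht1 : t < 1)
    {v : EuclideanSpace ℝ (Fin n)} (hv : v ≠ 0) :
    (weightLaw m n).real {W | ‖linearLayer (Matrix.of W) v‖ ^ 2 ≤ (1 - t) * ‖v‖ ^ 2}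
      ≤ Real.exp (m * ((t ^ 3 - t ^ 2) / 4)) := by
  have hm' : (0 : ℝ) < m := by exact_mod_cast hm
  have hv' : 0 < ‖v‖ ^ 2 := by have := norm_pos_iff.2 hv; positivity
  have hu : ‖(‖v‖⁻¹ • v)‖ = 1 := norm_smul_inv_norm hv
  refine le_trans (le_of_eq ?_) (sum_sq_lower_tail m ht ht1)
  rw [← (measurePreserving_rows (m := m) hu).measureReal_preimage
    (measurableSet_le (by fun_prop) (by fun_prop)).nullMeasurableSet]
  congr 1
  ext W
  simp only [Set.mem_ofPred_eq, Set.mem_preimage]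
  rw [norm_linearLayer_sq_eq_normalized _ hv, mul_comm (1 - t), mul_le_mul_iff_right₀ hv',
    inv_mul_le_iff₀ hm', mul_comm (m : ℝ)]
  rfl

/-- **Johnson–Lindenstrauss lemma** for the initial first layer: it nearly preserves the distances
between the points of `X`, outside an event of small probability. An arbitrary order on the points
assigns the two tails of the event for `{p, q}` to the ordered pairs `(p, q)` and `(q, p)`. -/
theorem weightLaw_distortion_le {m n : ℕ} (hm : 0 < m) {t : ℝ} (ht : 0 ≤ t) (ht1 : t < 1)
    (X : Finset (EuclideanSpace ℝ (Fin n))) :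
    (weightLaw m n).real {W | ∃ p ∈ X, ∃ q ∈ X, p ≠ q ∧
        ¬((1 - t) * ‖p - q‖ ^ 2 ≤ ‖linearLayer (Matrix.of W) (p - q)‖ ^ 2 ∧
          ‖linearLayer (Matrix.of W) (p - q)‖ ^ 2 ≤ (1 + t) * ‖p - q‖ ^ 2)}
      ≤ (X.card : ℝ) * ((X.card : ℝ) - 1) * Real.exp (m * ((t ^ 3 - t ^ 2) / 4)) := by
  classical
  set bad : EuclideanSpace ℝ (Fin n) × EuclideanSpace ℝ (Fin n) → Set (Fin m → Fin n → ℝ) :=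
    fun pq => if WellOrderingRel pq.1 pq.2
      then {W | (1 + t) * ‖pq.1 - pq.2‖ ^ 2 ≤ ‖linearLayer (Matrix.of W) (pq.1 - pq.2)‖ ^ 2}
      else {W | ‖linearLayer (Matrix.of W) (pq.1 - pq.2)‖ ^ 2 ≤ (1 - t) * ‖pq.1 - pq.2‖ ^ 2}
    with hbad
  have hsymm : ∀ (W : Fin m → Fin n → ℝ) (p q : EuclideanSpace ℝ (Fin n)),
      ‖linearLayer (Matrix.of W) (p - q)‖ = ‖linearLayer (Matrix.of W) (q - p)‖ := by
    intro W p q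
    rw [← linearLayer_sub_apply, ← linearLayer_sub_apply, norm_sub_rev]
  have hmem : ∀ W p q, WellOrderingRel p q →
      ¬((1 - t) * ‖p - q‖ ^ 2 ≤ ‖linearLayer (Matrix.of W) (p - q)‖ ^ 2 ∧
          ‖linearLayer (Matrix.of W) (p - q)‖ ^ 2 ≤ (1 + t) * ‖p - q‖ ^ 2) →
      W ∈ bad (p, q) ∨ W ∈ bad (q, p) := by
    intro W p q hpq h
    rw [not_and_or, not_le, not_le] at h
    rcases h with h | h
    · right
      simp only [hbad, if_neg (asymm hpq), Set.mem_ofPred_eq]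
      rw [hsymm, norm_sub_rev q p]
      exact h.le
    · left
      simp only [hbad, if_pos hpq, Set.mem_ofPred_eq]
      exact h.le
  have hsub : {W | ∃ p ∈ X, ∃ q ∈ X, p ≠ q ∧
        ¬((1 - t) * ‖p - q‖ ^ 2 ≤ ‖linearLayer (Matrix.of W) (p - q)‖ ^ 2 ∧
          ‖linearLayer (Matrix.of W) (p - q)‖ ^ 2 ≤ (1 + t) * ‖p - q‖ ^ 2)}
      ⊆ ⋃ pq ∈ X.offDiag, bad pq := by
    rintro W ⟨p, hp, q, hq, hpq, h⟩
    have h' : W ∈ bad (p, q) ∨ W ∈ bad (q, p) := by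
      rcases trichotomous_of WellOrderingRel p q with hr | hr | hr
      · exact hmem W p q hr h
      · exact absurd hr hpq
      · refine (hmem W q p hr ?_).symm
        rwa [hsymm, norm_sub_rev q p]
    simp only [Set.mem_iUnion, exists_prop]
    rcases h' with h' | h'
    · exact ⟨(p, q), Finset.mem_offDiag.2 ⟨hp, hq, hpq⟩, h'⟩
    · exact ⟨(q, p), Finset.mem_offDiag.2 ⟨hq, hp, hpq.symm⟩, h'⟩
  refine (measureReal_mono hsub (measure_ne_top _ _)).trans ((measureReal_biUnion_finset_le _ _).trans ?_)
  have hcard : ((X.offDiag.card : ℕ) : ℝ) = (X.card : ℝ) * ((X.card : ℝ) - 1) := by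
    rw [Finset.offDiag_card, Nat.cast_sub (Nat.le_mul_self _)]
    push_cast
    ring
  rw [← hcard, ← nsmul_eq_mul]
  refine Finset.sum_le_card_nsmul _ _ _ fun pq hpq => ?_
  have hne : pq.1 - pq.2 ≠ 0 := sub_ne_zero.2 (Finset.mem_offDiag.1 hpq).2.2
  simp only [hbad]
  split_ifs
  · exact linearLayer_upper_tail hm ht hne
  · exact linearLayer_lower_tail hm ht ht1 hne

/-! ### The Gram matrix -/

theorem measurable_reluDeriv : Measurable reluDeriv :=
  Measurable.ite measurableSet_Ici measurable_const measurable_const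

/-- The contribution of a neuron with weights `w` to the entry of the Gram matrix for the data
points `u` and `v`. -/
noncomputable def gramIntegrand {n : ℕ} (u v : EuclideanSpace ℝ (Fin n)) (w : Fin n → ℝ) : ℝ :=
  u.ofLp ⬝ᵥ v.ofLp * (reluDeriv (w ⬝ᵥ u.ofLp) * reluDeriv (w ⬝ᵥ v.ofLp))

theorem measurable_gramIntegrand {n : ℕ} (u v : EuclideanSpace ℝ (Fin n)) :
    Measurable (gramIntegrand u v) :=
  measurable_const.mul ((measurable_reluDeriv.comp (measurable_dotProduct _)).mul
    (measurable_reluDeriv.comp (measurable_dotProduct _)))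

theorem abs_gramIntegrand_le_one {n : ℕ} {u v : EuclideanSpace ℝ (Fin n)} (hu : ‖u‖ = 1)
    (hv : ‖v‖ = 1) (w : Fin n → ℝ) : |gramIntegrand u v w| ≤ 1 := by
  rw [gramIntegrand, abs_mul, abs_mul]
  exact mul_le_one₀ (abs_dotProduct_unit_le_one hu hv) (by positivity)
    (mul_le_one₀ (abs_reluDeriv_le_one _) (abs_nonneg _) (abs_reluDeriv_le_one _))

theorem memLp_gramIntegrand {n : ℕ} {u v : EuclideanSpace ℝ (Fin n)} (hu : ‖u‖ = 1)
    (hv : ‖v‖ = 1) : MemLp (gramIntegrand u v) 2 (gaussianVec n) :=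
  MemLp.of_bound (measurable_gramIntegrand u v).aestronglyMeasurable 1
    (ae_of_all _ fun w => abs_gramIntegrand_le_one hu hv w)

theorem gramMatrix_apply {n N : ℕ} (x : Fin N → EuclideanSpace ℝ (Fin n)) (i j : Fin N) :
    gramMatrix x i j = ∫ w, gramIntegrand (x i) (x j) w ∂(gaussianVec n) := by
  simp only [gramMatrix, Matrix.of_apply]
  refine integral_congr_ae (ae_of_all _ fun w => ?_)
  simp only [Set.indicator_apply, Set.mem_ofPred_eq, gramIntegrand, reluDeriv]
  by_cases h1 : 0 ≤ w ⬝ᵥ (x i).ofLp <;> by_cases h2 : 0 ≤ w ⬝ᵥ (x j).ofLp <;> simp [h1, h2]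

theorem abs_gramMatrix_le_one {n N : ℕ} {x : Fin N → EuclideanSpace ℝ (Fin n)}
    (hx : ∀ i, ‖x i‖ = 1) (i j : Fin N) : |gramMatrix x i j| ≤ 1 := by
  rw [gramMatrix_apply]
  have h := norm_integral_le_of_norm_le_const (μ := gaussianVec n) (C := 1)
    (f := gramIntegrand (x i) (x j))
    (ae_of_all _ fun w => abs_gramIntegrand_le_one (hx i) (hx j) w)
  simpa using h

theorem gramMatrix_isHermitian {n N : ℕ} (x : Fin N → EuclideanSpace ℝ (Fin n)) :
    (gramMatrix x).IsHermitian := by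
  ext i j
  rw [Matrix.conjTranspose_apply, star_trivial, gramMatrix_apply, gramMatrix_apply]
  congr 1
  funext w
  simp only [gramIntegrand]
  rw [dotProduct_comm (x j).ofLp]
  ring

/-- Rayleigh's bound for the smallest element of the spectrum of a real symmetric matrix. -/
theorem sInf_spectrum_mul_le {N : ℕ} {A : Matrix (Fin N) (Fin N) ℝ} (hA : A.IsHermitian)
    (z : EuclideanSpace ℝ (Fin N)) :
    sInf (spectrum ℝ A) * ‖z‖ ^ 2 ≤ ∑ i, ∑ j, z i * A i j * z j := by
  set lam := sInf (spectrum ℝ A) with hlam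
  have hB : (A - algebraMap ℝ _ lam).IsHermitian := by
    refine hA.sub ?_
    rw [Matrix.algebraMap_eq_diagonal]
    exact Matrix.isHermitian_diagonal _
  have hpos : (A - algebraMap ℝ _ lam).PosSemidef := by
    rw [hB.posSemidef_iff_eigenvalues_nonneg]
    intro i
    have h1 : hB.eigenvalues i ∈ spectrum ℝ (A - algebraMap ℝ _ lam) := by
      rw [hB.spectrum_real_eq_range_eigenvalues]
      exact ⟨i, rfl⟩
    rw [← spectrum.sub_singleton_eq, Set.sub_singleton] at h1
    obtain ⟨μ, hμ, h2⟩ := h1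
    have h3 : lam ≤ μ := csInf_le (Matrix.finite_spectrum A).bddBelow hμ
    simp only [Pi.zero_apply]
    rw [← h2]
    linarith
  have h := hpos.dotProduct_mulVec_nonneg z.ofLp
  rw [Matrix.sub_mulVec, dotProduct_sub, Algebra.algebraMap_eq_smul_one, Matrix.smul_mulVec,
    Matrix.one_mulVec, dotProduct_smul, star_trivial, smul_eq_mul] at h
  have h4 : z.ofLp ⬝ᵥ z.ofLp = ‖z‖ ^ 2 := by
    rw [EuclideanSpace.norm_sq_eq]
    simp [dotProduct, sq]
  have h5 : z.ofLp ⬝ᵥ A *ᵥ z.ofLp = ∑ i, ∑ j, z i * A i j * z j := by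
    simp only [dotProduct, Matrix.mulVec, Finset.mul_sum, mul_assoc]
  rw [h4, h5] at h
  linarith

theorem gramMinEigenvalue_le_one {n N : ℕ} (hN : 0 < N) {x : Fin N → EuclideanSpace ℝ (Fin n)}
    (hx : ∀ i, ‖x i‖ = 1) : gramMinEigenvalue x ≤ 1 := by
  have h := sInf_spectrum_mul_le (gramMatrix_isHermitian x)
    (EuclideanSpace.single (⟨0, hN⟩ : Fin N) (1 : ℝ))
  have h1 := (abs_le.1 (abs_gramMatrix_le_one hx (⟨0, hN⟩ : Fin N) ⟨0, hN⟩)).2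
  simp [PiLp.single_apply] at h
  exact h.trans h1

/-- Entrywise closeness to the Gram matrix preserves most of its lower bound. -/
theorem empiricalGram_coercive {m n N : ℕ} (hN : 0 < N) {x : Fin N → EuclideanSpace ℝ (Fin n)}
    {W : Matrix (Fin m) (Fin n) ℝ} (hlam : 0 < gramMinEigenvalue x)
    (h : ∀ i j, |empiricalGram x W i j - gramMatrix x i j| ≤ gramMinEigenvalue x / (4 * N))
    (z : EuclideanSpace ℝ (Fin N)) :
    3 / 4 * gramMinEigenvalue x * ‖z‖ ^ 2 ≤ ∑ i, ∑ j, z i * empiricalGram x W i j * z j := by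
  have hN' : (0 : ℝ) < N := by exact_mod_cast hN
  have h1 : gramMinEigenvalue x * ‖z‖ ^ 2 ≤ ∑ i, ∑ j, z i * gramMatrix x i j * z j :=
    sInf_spectrum_mul_le (gramMatrix_isHermitian x) z
  set lam := gramMinEigenvalue x
  have h2 : ∑ i, ∑ j, z i * gramMatrix x i j * z j
      - ∑ i, ∑ j, z i * empiricalGram x W i j * z j
      ≤ ∑ i, ∑ j, |z i| * |z j| * (lam / (4 * N)) := by
    simp only [← Finset.sum_sub_distrib]
    refine Finset.sum_le_sum fun i _ => Finset.sum_le_sum fun j _ => ?_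
    have h3 : z i * gramMatrix x i j * z j - z i * empiricalGram x W i j * z j
        = -(z i * z j * (empiricalGram x W i j - gramMatrix x i j)) := by ring
    rw [h3]
    refine (neg_le_abs _).trans ?_
    rw [abs_mul, abs_mul]
    exact mul_le_mul_of_nonneg_left (h i j) (by positivity)
  have h4 : ∑ i, ∑ j, |z i| * |z j| * (lam / (4 * N)) = (∑ i, |z i|) ^ 2 * (lam / (4 * N)) := by
    rw [sq, Finset.sum_mul_sum, Finset.sum_mul]
    exact Finset.sum_congr rfl fun i _ => (Finset.sum_mul _ _ _).symm
  have h5 : (∑ i, |z i|) ^ 2 * (lam / (4 * N)) ≤ lam / 4 * ‖z‖ ^ 2 := by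
    calc _ ≤ (Real.sqrt N * ‖z‖) ^ 2 * (lam / (4 * N)) := by
          gcongr
          exact sum_abs_le_sqrt_mul_norm z
      _ = lam / 4 * ‖z‖ ^ 2 := by
          rw [mul_pow, Real.sq_sqrt hN'.le]
          field_simp
  linarith

/-! ### Typical behaviour of the initialization -/

theorem measurePreserving_row {m n : ℕ} (r : Fin m) :
    MeasurePreserving (fun W : Fin m → Fin n → ℝ => W r) (weightLaw m n) (gaussianVec n) :=
  measurePreserving_eval (fun _ : Fin m => gaussianVec n) r

/-- Chebyshev's inequality for the entries of the empirical Gram matrix at initialization. -/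
theorem weightLaw_gram_deviation_le {m n N : ℕ} (hm : 0 < m)
    {x : Fin N → EuclideanSpace ℝ (Fin n)} (hx : ∀ i, ‖x i‖ = 1) (i j : Fin N) {c : ℝ}
    (hc : 0 < c) :
    (weightLaw m n).real {W | c ≤ |empiricalGram x (Matrix.of W) i j - gramMatrix x i j|}
      ≤ 1 / (m * c ^ 2) := by
  have hm' : (0 : ℝ) < m := by exact_mod_cast hm
  have hL := memLp_gramIntegrand (hx i) (hx j)
  set Y : (Fin m → Fin n → ℝ) → ℝ :=
    fun W => (m : ℝ)⁻¹ * (∑ r, fun W : Fin m → Fin n → ℝ => gramIntegrand (x i) (x j) (W r)) W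
    with hY
  have hYe : ∀ W, Y W = empiricalGram x (Matrix.of W) i j := fun W => by
    simp only [hY, Finset.sum_apply]; rfl
  have hrow : ∀ r : Fin m, MemLp (fun W : Fin m → Fin n → ℝ => gramIntegrand (x i) (x j) (W r)) 2
      (weightLaw m n) := fun r => hL.comp_measurePreserving (measurePreserving_row r)
  have hYL : MemLp Y 2 (weightLaw m n) := (memLp_finsetSum' _ fun r _ => hrow r).const_mul _
  have hmean : ∫ W, Y W ∂(weightLaw m n) = gramMatrix x i j := by
    simp only [hY, Finset.sum_apply]
    rw [integral_const_mul, integral_finsetSum _ fun r _ => (hrow r).integrable one_le_two]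
    have h1 : ∀ r : Fin m, ∫ W, gramIntegrand (x i) (x j) (W r) ∂(weightLaw m n)
        = gramMatrix x i j := by
      intro r
      rw [gramMatrix_apply, ← (measurePreserving_row (m := m) r).map_eq,
        integral_map (measurePreserving_row r).measurable.aemeasurable
          (measurable_gramIntegrand _ _).aestronglyMeasurable]
    simp [h1, hm'.ne']
  have hvar : Var[Y; weightLaw m n] ≤ (m : ℝ)⁻¹ := by
    rw [hY, variance_const_mul, variance_sum_pi fun _ => hL]
    have h1 : Var[gramIntegrand (x i) (x j); gaussianVec n] ≤ 1 := by
      refine (variance_le_sq_of_bounded (a := -1) (b := 1)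
        (ae_of_all _ fun w => abs_le.1 (abs_gramIntegrand_le_one (hx i) (hx j) w))
        (measurable_gramIntegrand _ _).aemeasurable).trans (by norm_num)
    rw [Finset.sum_const, Finset.card_univ, Fintype.card_fin, nsmul_eq_mul]
    calc (m : ℝ)⁻¹ ^ 2 * (m * _) ≤ (m : ℝ)⁻¹ ^ 2 * (m * 1) := by gcongr
      _ = (m : ℝ)⁻¹ := by field_simp
  have h := meas_ge_le_variance_div_sq hYL hc
  rw [hmean] at h
  simp only [hYe] at h
  refine (ENNReal.toReal_mono ENNReal.ofReal_ne_top h).trans ?_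
  rw [ENNReal.toReal_ofReal (div_nonneg (variance_nonneg _ _) (by positivity))]
  calc Var[Y; weightLaw m n] / c ^ 2 ≤ (m : ℝ)⁻¹ / c ^ 2 := by gcongr
    _ = 1 / (m * c ^ 2) := by field_simp

theorem measurable_nearKink (R : ℝ) : Measurable (nearKink R) :=
  Measurable.ite (measurableSet_le (by fun_prop) (by fun_prop)) measurable_const measurable_const

/-- The standard normal density is at most `1 / 2`. -/
theorem integral_nearKink_le {R : ℝ} (hR : 0 ≤ R) :
    ∫ g, nearKink R g ∂(gaussianReal 0 1) ≤ R := by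
  have h1 : nearKink R = Set.indicator (Set.Icc (-R) R) 1 := by
    funext g
    simp [nearKink, Set.indicator_apply, abs_le]
  rw [h1, integral_indicator_one measurableSet_Icc, measureReal_def, gaussianReal_apply 0 one_ne_zero]
  have h2 : ∀ g, gaussianPDF 0 1 g ≤ ENNReal.ofReal (1 / 2) := by
    intro g
    rw [gaussianPDF]
    refine ENNReal.ofReal_le_ofReal ?_
    rw [gaussianPDFReal]
    have h3 : (2 : ℝ) ≤ Real.sqrt (2 * Real.pi * (1 : NNReal)) := by
      refine Real.le_sqrt_of_sq_le ?_
      simp only [NNReal.coe_one, mul_one]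
      linarith [Real.pi_gt_three]
    have h4 : (Real.sqrt (2 * Real.pi * (1 : NNReal)))⁻¹ ≤ 1 / 2 := by
      rw [one_div]
      exact inv_anti₀ (by norm_num) h3
    refine (mul_le_of_le_one_right (by positivity) (Real.exp_le_one_iff.2 ?_)).trans h4
    rw [neg_div]
    exact neg_nonpos.2 (by positivity)
  have h3 : ∫⁻ g in Set.Icc (-R) R, gaussianPDF 0 1 g ≤ ENNReal.ofReal R := by
    refine (setLIntegral_mono measurable_const fun g _ => h2 g).trans ?_
    rw [setLIntegral_const, Real.volume_Icc, ← ENNReal.ofReal_mul (by norm_num)]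
    exact ENNReal.ofReal_le_ofReal (by linarith)
  exact (ENNReal.toReal_mono ENNReal.ofReal_ne_top h3).trans (ENNReal.toReal_ofReal hR).le

/-- Few neurons are near a kink at initialization. -/
theorem weightLaw_nearKink_le {m n N : ℕ} {x : Fin N → EuclideanSpace ℝ (Fin n)}
    (hx : ∀ i, ‖x i‖ = 1) {R M : ℝ} (hR : 0 ≤ R) (hM : 0 < M) :
    (weightLaw m n).real {W | M ≤ ∑ i, ∑ r, nearKink R (W r ⬝ᵥ (x i).ofLp)} ≤ N * m * R / M := by
  have hmeas : ∀ (i : Fin N) (r : Fin m),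
      Measurable fun W : Fin m → Fin n → ℝ => nearKink R (W r ⬝ᵥ (x i).ofLp) := fun i r =>
    (measurable_nearKink R).comp ((measurable_dotProduct _).comp (measurable_pi_apply r))
  have hint : ∀ (i : Fin N) (r : Fin m),
      Integrable (fun W : Fin m → Fin n → ℝ => nearKink R (W r ⬝ᵥ (x i).ofLp)) (weightLaw m n) := by
    intro i r
    refine Integrable.of_bound (hmeas i r).aestronglyMeasurable 1 (ae_of_all _ fun W => ?_)
    unfold nearKink
    split_ifs <;> simp
  have hmain := mul_meas_ge_le_integral_of_nonneg (μ := weightLaw m n)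
    (f := fun W => ∑ i, ∑ r, nearKink R (W r ⬝ᵥ (x i).ofLp))
    (ae_of_all _ fun W => Finset.sum_nonneg fun i _ => Finset.sum_nonneg fun r _ =>
      nearKink_nonneg _ _)
    (integrable_finsetSum _ fun i _ => integrable_finsetSum _ fun r _ => hint i r) M
  rw [le_div_iff₀ hM, mul_comm]
  refine hmain.trans ?_
  rw [integral_finsetSum _ fun i _ => integrable_finsetSum _ fun r _ => hint i r]
  have h1 : ∀ i : Fin N, ∫ W, ∑ r, nearKink R (W r ⬝ᵥ (x i).ofLp) ∂(weightLaw m n) ≤ m * R := by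
    intro i
    rw [integral_finsetSum _ fun r _ => hint i r]
    have h2 : ∀ r : Fin m, ∫ W, nearKink R (W r ⬝ᵥ (x i).ofLp) ∂(weightLaw m n) ≤ R := by
      intro r
      refine le_trans (le_of_eq ?_) (integral_nearKink_le hR)
      have hmp := (measurePreserving_dotProduct (hx i)).comp (measurePreserving_row (m := m) r)
      rw [← hmp.map_eq, integral_map hmp.measurable.aemeasurable
        (measurable_nearKink R).aestronglyMeasurable]
      rfl
    simpa using Finset.sum_le_card_nsmul Finset.univ _ R fun r _ => h2 r
  refine (Finset.sum_le_card_nsmul _ _ _ fun i _ => h1 i).trans (le_of_eq ?_)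
  simp [mul_assoc]

theorem ae_abs_signLaw : ∀ᵐ s ∂signLaw, |s| = 1 := by
  refine Measure.ae_smul_measure ?_ _
  rw [ae_add_measure_iff]
  constructor <;> rw [ae_dirac_eq] <;> simp

theorem memLp_id_signLaw : MemLp (fun s => s) 2 signLaw :=
  MemLp.of_bound measurable_id.aestronglyMeasurable 1 (ae_abs_signLaw.mono fun _ h => h.le)

theorem integral_id_signLaw : ∫ s, s ∂signLaw = 0 := by
  rw [signLaw, integral_smul_measure, integral_add_measure (integrable_dirac (by simp))
    (integrable_dirac (by simp)), integral_dirac, integral_dirac]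
  simp

theorem variance_id_signLaw : Var[fun s => s; signLaw] = 1 := by
  rw [variance_of_integral_eq_zero measurable_id'.aemeasurable integral_id_signLaw]
  have h : ∫ s, s ^ 2 ∂signLaw = ∫ _, (1 : ℝ) ∂signLaw :=
    integral_congr_ae (ae_abs_signLaw.mono fun s hs => by
      change s ^ 2 = 1
      rw [← sq_abs, hs, one_pow])
  rw [h]
  simp

theorem ae_abs_pi_signLaw (m : ℕ) :
    ∀ᵐ a ∂(Measure.pi fun _ : Fin m => signLaw), ∀ r, |a r| = 1 :=
  ae_all_iff.2 fun r =>
    (measurePreserving_eval (fun _ : Fin m => signLaw) r).quasiMeasurePreserving.ae ae_abs_signLaw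

/-- Random signs are uncorrelated, so that the second moment of a signed sum is the sum of
squares. -/
theorem lintegral_sq_signed_sum {m : ℕ} (h : Fin m → ℝ) :
    ∫⁻ a, ENNReal.ofReal ((∑ r, a r * h r) ^ 2) ∂(Measure.pi fun _ : Fin m => signLaw)
      = ENNReal.ofReal (∑ r, h r ^ 2) := by
  have hL : ∀ r, MemLp (fun s => s * h r) 2 signLaw := fun r => memLp_id_signLaw.mul_const _
  have hrow : ∀ r, MemLp (fun a : Fin m → ℝ => a r * h r) 2
      (Measure.pi fun _ : Fin m => signLaw) := fun r =>
    (hL r).comp_measurePreserving (measurePreserving_eval (fun _ : Fin m => signLaw) r)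
  have hY := memLp_finsetSum' Finset.univ fun r _ => hrow r
  have hmean : ∫ a, (∑ r, fun a : Fin m → ℝ => a r * h r) a
      ∂(Measure.pi fun _ : Fin m => signLaw) = 0 := by
    simp only [Finset.sum_apply]
    rw [integral_finsetSum _ fun r _ => (hrow r).integrable one_le_two]
    refine Finset.sum_eq_zero fun r _ => ?_
    have h1 : (Measure.pi fun _ : Fin m => signLaw).map (fun a => a r) = signLaw :=
      (measurePreserving_eval (fun _ : Fin m => signLaw) r).map_eq
    have h2 := integral_map (μ := Measure.pi fun _ : Fin m => signLaw) (φ := fun a => a r)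
      (f := fun s : ℝ => s) (measurable_pi_apply r).aemeasurable
      measurable_id'.aestronglyMeasurable
    rw [h1, integral_id_signLaw] at h2
    rw [integral_mul_const, ← h2, zero_mul]
  have hvar : Var[∑ r, fun a : Fin m → ℝ => a r * h r; Measure.pi fun _ : Fin m => signLaw]
      = ∑ r, h r ^ 2 := by
    rw [variance_sum_pi hL]
    refine Finset.sum_congr rfl fun r _ => ?_
    rw [variance_mul_const, variance_id_signLaw, one_mul]
  rw [variance_of_integral_eq_zero hY.aestronglyMeasurable.aemeasurable hmean] at hvar
  rw [← hvar, ofReal_integral_eq_lintegral_ofReal hY.integrable_sq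
    (ae_of_all _ fun a => sq_nonneg _)]
  simp only [Finset.sum_apply]

theorem lintegral_sq_gaussianReal : ∫⁻ g, ENNReal.ofReal (g ^ 2) ∂(gaussianReal 0 1) = 1 := by
  have hL : MemLp (fun x : ℝ => x) 2 (gaussianReal 0 1) := memLp_id_gaussianReal 2
  have hvar := variance_fun_id_gaussianReal (μ := 0) (v := 1)
  rw [variance_of_integral_eq_zero measurable_id'.aemeasurable integral_id_gaussianReal] at hvar
  rw [← ofReal_integral_eq_lintegral_ofReal hL.integrable_sq (ae_of_all _ fun a => sq_nonneg _),
    hvar]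
  simp

theorem measurable_network {m n : ℕ} (v : EuclideanSpace ℝ (Fin n)) :
    Measurable fun p : (Fin m → Fin n → ℝ) × (Fin m → ℝ) => network p.2 (Matrix.of p.1) v := by
  unfold network relu
  refine Finset.measurable_sum _ fun r _ => Measurable.mul (by fun_prop)
    (measurable_const.max ?_)
  simp only [linearLayer_apply]
  exact measurable_const.mul
    ((measurable_dotProduct _).comp ((measurable_pi_apply r).comp measurable_fst))

theorem relu_sq_le (z : ℝ) : relu z ^ 2 ≤ z ^ 2 := by
  unfold relu
  rcases max_cases 0 z with ⟨h, _⟩ | ⟨h, _⟩ <;> rw [h]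
  simpa using sq_nonneg z

/-- At initialization the second moment of the network output at a unit vector is at most `1`. -/
theorem lintegral_network_sq_le {m n : ℕ} (hm : 0 < m) {v : EuclideanSpace ℝ (Fin n)}
    (hv : ‖v‖ = 1) :
    ∫⁻ p, ENNReal.ofReal (network p.2 (Matrix.of p.1) v ^ 2) ∂(initLaw m n) ≤ 1 := by
  have hm' : (0 : ℝ) < m := by exact_mod_cast hm
  rw [initLaw, lintegral_prod _ ((measurable_network v).pow_const 2).ennreal_ofReal.aemeasurable]
  have h1 : ∀ W : Fin m → Fin n → ℝ,
      ∫⁻ a, ENNReal.ofReal (network a (Matrix.of W) v ^ 2)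
          ∂(Measure.pi fun _ : Fin m => signLaw)
        ≤ ∑ r, ENNReal.ofReal (m : ℝ)⁻¹ * ENNReal.ofReal ((W r ⬝ᵥ v.ofLp) ^ 2) := by
    intro W
    simp only [network]
    rw [lintegral_sq_signed_sum, ENNReal.ofReal_sum_of_nonneg fun r _ => sq_nonneg _]
    refine Finset.sum_le_sum fun r _ => ?_
    rw [← ENNReal.ofReal_mul (by positivity)]
    refine ENNReal.ofReal_le_ofReal ((relu_sq_le _).trans (le_of_eq ?_))
    rw [linearLayer_apply, mul_pow, inv_pow, Real.sq_sqrt hm'.le]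
    rfl
  refine (lintegral_mono h1).trans ?_
  have hmeas : ∀ r : Fin m, Measurable fun W : Fin m → Fin n → ℝ =>
      ENNReal.ofReal ((W r ⬝ᵥ v.ofLp) ^ 2) := fun r =>
    (((measurable_dotProduct _).comp (measurable_pi_apply r)).pow_const 2).ennreal_ofReal
  rw [lintegral_finsetSum _ fun r _ => (hmeas r).const_mul _]
  have h2 : ∀ r : Fin m, ∫⁻ W, ENNReal.ofReal (m : ℝ)⁻¹ * ENNReal.ofReal ((W r ⬝ᵥ v.ofLp) ^ 2)
      ∂(weightLaw m n) = ENNReal.ofReal (m : ℝ)⁻¹ := by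
    intro r
    rw [lintegral_const_mul _ (hmeas r)]
    have hmp := (measurePreserving_dotProduct hv).comp (measurePreserving_row (m := m) r)
    have h3 := hmp.lintegral_comp (f := fun g => ENNReal.ofReal (g ^ 2)) (by fun_prop)
    rw [lintegral_sq_gaussianReal] at h3
    exact (congrArg (ENNReal.ofReal (m : ℝ)⁻¹ * ·) h3).trans (mul_one _)
  rw [Finset.sum_congr rfl fun r _ => h2 r, Finset.sum_const, Finset.card_univ, Fintype.card_fin,
    nsmul_eq_mul, ← ENNReal.ofReal_natCast, ← ENNReal.ofReal_mul hm'.le,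
    mul_inv_cancel₀ hm'.ne', ENNReal.ofReal_one]

/-- Markov's inequality for the squared residuals at initialization: their sum is of order `N`. -/
theorem initLaw_residual_le {m n N : ℕ} (hm : 0 < m) {x : Fin N → EuclideanSpace ℝ (Fin n)}
    (hx : ∀ i, ‖x i‖ = 1) {y : EuclideanSpace ℝ (Fin N)} {C : ℝ} (hy : ∀ i, |y i| ≤ C) {M : ℝ}
    (hM : 0 < M) :
    (initLaw m n).real {p | 2 * (M + N * C ^ 2) ≤ ‖predictions x p.2 (Matrix.of p.1) - y‖ ^ 2}
      ≤ N / M := by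
  have hsub : {p : (Fin m → Fin n → ℝ) × (Fin m → ℝ) |
        2 * (M + N * C ^ 2) ≤ ‖predictions x p.2 (Matrix.of p.1) - y‖ ^ 2}
      ⊆ {p | ENNReal.ofReal M ≤ ∑ i, ENNReal.ofReal (network p.2 (Matrix.of p.1) (x i) ^ 2)} := by
    intro p hp
    rw [Set.mem_ofPred_eq] at hp ⊢
    rw [← ENNReal.ofReal_sum_of_nonneg fun i _ => sq_nonneg _]
    refine ENNReal.ofReal_le_ofReal ?_
    have h1 : ‖predictions x p.2 (Matrix.of p.1) - y‖ ^ 2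
        ≤ ∑ i, (2 * network p.2 (Matrix.of p.1) (x i) ^ 2 + 2 * C ^ 2) := by
      rw [EuclideanSpace.norm_sq_eq]
      refine Finset.sum_le_sum fun i _ => ?_
      rw [Real.norm_eq_abs, sq_abs, PiLp.sub_apply]
      change (network p.2 (Matrix.of p.1) (x i) - y i) ^ 2 ≤ _
      have h2 : y i ^ 2 ≤ C ^ 2 := sq_le_sq' (abs_le.1 (hy i)).1 (abs_le.1 (hy i)).2
      nlinarith [sq_nonneg (network p.2 (Matrix.of p.1) (x i) + y i)]
    rw [Finset.sum_add_distrib, ← Finset.mul_sum] at h1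
    simp only [Finset.sum_const, Finset.card_univ, Fintype.card_fin, nsmul_eq_mul] at h1
    linarith
  have hmeas : ∀ i : Fin N, Measurable fun p : (Fin m → Fin n → ℝ) × (Fin m → ℝ) =>
      ENNReal.ofReal (network p.2 (Matrix.of p.1) (x i) ^ 2) := fun i =>
    ((measurable_network (x i)).pow_const 2).ennreal_ofReal
  have h1 := meas_ge_le_lintegral_div (μ := initLaw m n)
    (Finset.measurable_sum Finset.univ fun i _ => hmeas i).aemeasurable
    (ENNReal.ofReal_pos.2 hM).ne' ENNReal.ofReal_ne_top
  rw [lintegral_finsetSum _ fun i _ => hmeas i] at h1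
  have h2 : ∑ i, ∫⁻ p, ENNReal.ofReal (network p.2 (Matrix.of p.1) (x i) ^ 2) ∂(initLaw m n)
      ≤ ENNReal.ofReal N := by
    refine (Finset.sum_le_card_nsmul _ _ _ fun i _ => lintegral_network_sq_le hm (hx i)).trans ?_
    simp
  have h3 := (measure_mono hsub).trans (h1.trans (ENNReal.div_le_div_right h2 _))
  rw [← ENNReal.ofReal_div_of_pos hM] at h3
  exact (ENNReal.toReal_mono ENNReal.ofReal_ne_top h3).trans
    (ENNReal.toReal_ofReal (by positivity)).le

/-! ### Preservation of the nearest neighbour graph during training -/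

/-- The initial layer distorts distances by at most `√(1 ± ε / 2)`, and training moves the layer by
at most `ε / 2` in operator norm. -/
theorem linearLayer_distortion {m n : ℕ} {W₀ W : Matrix (Fin m) (Fin n) ℝ} {ε : ℝ}
    (hε0 : 0 < ε) (hε1 : ε < 1) {p q : EuclideanSpace ℝ (Fin n)} (hpq : p ≠ q)
    (hJL : (1 - ε / 2) * ‖p - q‖ ^ 2 ≤ ‖linearLayer W₀ (p - q)‖ ^ 2 ∧
      ‖linearLayer W₀ (p - q)‖ ^ 2 ≤ (1 + ε / 2) * ‖p - q‖ ^ 2)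
    (hW : ‖linearLayer W (p - q) - linearLayer W₀ (p - q)‖ ≤ ε / 2 * ‖p - q‖) :
    (1 - ε) * dist p q < dist (linearLayer W p) (linearLayer W q) ∧
      dist (linearLayer W p) (linearLayer W q) < (1 + ε) * dist p q := by
  rw [dist_eq_norm, dist_eq_norm, linearLayer_sub_apply]
  have hd : 0 < ‖p - q‖ := norm_pos_iff.2 (sub_ne_zero.2 hpq)
  set d := ‖p - q‖
  set A := ‖linearLayer W₀ (p - q)‖
  have hA0 : 0 ≤ A := norm_nonneg _
  have hd2 : 0 < d ^ 2 := by positivity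
  have h1 : A < (1 + ε / 2) * d := by
    refine lt_of_pow_lt_pow_left₀ 2 (by positivity) (hJL.2.trans_lt ?_)
    rw [mul_pow]
    exact mul_lt_mul_of_pos_right (by nlinarith) hd2
  have h2 : (1 - ε / 2) * d < A := by
    refine lt_of_pow_lt_pow_left₀ 2 hA0 (lt_of_lt_of_le ?_ hJL.1)
    rw [mul_pow]
    exact mul_lt_mul_of_pos_right (by nlinarith) hd2
  have h3 := abs_le.1 ((abs_norm_sub_norm_le _ _).trans hW)
  constructor <;> linarith [h3.1, h3.2]

/-- The event of good initializations: the signs of the second layer are `±1`, the empirical Gram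
matrix is close to its mean, few neurons are within `R` of a kink, the residuals are small, and the
first layer nearly preserves the distances in `X`. -/
structure GoodInit {m n N : ℕ} (x : Fin N → EuclideanSpace ℝ (Fin n))
    (y : EuclideanSpace ℝ (Fin N)) (X : Finset (EuclideanSpace ℝ (Fin n))) (ε R M : ℝ)
    (W : Matrix (Fin m) (Fin n) ℝ) (a : Fin m → ℝ) : Prop where
  sign : ∀ r, |a r| = 1
  gram : ∀ i j, |empiricalGram x W i j - gramMatrix x i j| ≤ gramMinEigenvalue x / (4 * N)
  kink : ∑ i, ∑ r, nearKink R (W r ⬝ᵥ (x i).ofLp) ≤ m * gramMinEigenvalue x / (16 * N)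
  residual : ‖predictions x a W - y‖ ^ 2 ≤ M
  distortion : ∀ p ∈ X, ∀ q ∈ X, p ≠ q →
    (1 - ε / 2) * ‖p - q‖ ^ 2 ≤ ‖linearLayer W (p - q)‖ ^ 2 ∧
      ‖linearLayer W (p - q)‖ ^ 2 ≤ (1 + ε / 2) * ‖p - q‖ ^ 2

/-- Gradient descent from a good initialization preserves the nearest neighbour graph. -/
theorem GoodInit.isKnnGraphIso {m n N k : ℕ} (hm : 0 < m) (hN : 0 < N)
    {x : Fin N → EuclideanSpace ℝ (Fin n)} (hx : ∀ i, ‖x i‖ = 1)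
    {y : EuclideanSpace ℝ (Fin N)} {X : Finset (EuclideanSpace ℝ (Fin n))} {ε R M η : ℝ}
    (hε0 : 0 < ε) (hε1 : ε < 1)
    (hX : ∀ p ∈ X, knnRadius k X p
      ≤ ENNReal.ofReal ((1 - ε) / (1 + ε)) * knnRadius (k + 1) X p)
    (hlam : 0 < gramMinEigenvalue x) (hη : 0 < η)
    (hηN : η * (N : ℝ) ^ 2 ≤ gramMinEigenvalue x / 10) (hR : 0 ≤ R)
    (hRM : 16 * N * M ≤ R ^ 2 * (m * gramMinEigenvalue x ^ 2))
    {W : Matrix (Fin m) (Fin n) ℝ} {a : Fin m → ℝ} (h : GoodInit x y X ε R M W a)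
    (hwidth : 64 * (N : ℝ) * ‖predictions x a W - y‖ ^ 2 / (ε ^ 2 * gramMinEigenvalue x ^ 2)
      ≤ (m : ℝ)) (l : ℕ) :
    IsKnnGraphIso k (X : Set (EuclideanSpace ℝ (Fin n))) (linearLayer (gdWeights x y η a W l)) := by
  have hm' : (0 : ℝ) < m := by exact_mod_cast hm
  have hN' : (0 : ℝ) < N := by exact_mod_cast hN
  have hlam1 := gramMinEigenvalue_le_one hN hx
  set lam := gramMinEigenvalue x with hlam_def
  set z := ‖predictions x a W - y‖ with hz
  have hsm : 0 < Real.sqrt m := Real.sqrt_pos.2 hm'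
  set D := 4 * Real.sqrt N * z / (Real.sqrt m * lam) with hD
  have hDsq : D ^ 2 = 16 * N * z ^ 2 / (m * lam ^ 2) := by
    rw [hD, div_pow, mul_pow, mul_pow, mul_pow, Real.sq_sqrt hN'.le, Real.sq_sqrt hm'.le]
    norm_num
  have hD0 : 0 ≤ D := by positivity
  -- the width is large enough for the displacement to stay within the radius `R` of `h.kink`
  have hDR : D ≤ R := by
    refine le_of_sq_le_sq ?_ hR
    rw [hDsq, div_le_iff₀ (by positivity)]
    refine le_trans ?_ hRM
    exact mul_le_mul_of_nonneg_left h.residual (by positivity)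
  have hDε : D ≤ ε / 2 := by
    refine le_of_sq_le_sq ?_ (by positivity)
    rw [div_le_iff₀ (by positivity)] at hwidth
    rw [hDsq, div_le_iff₀ (by positivity)]
    nlinarith
  have hB : 2 * N * ∑ i, ∑ r, nearKink R (W r ⬝ᵥ (x i).ofLp) ≤ m * (lam / 8) := by
    have h1 := h.kink
    rw [le_div_iff₀ (by positivity)] at h1
    linarith
  have hmove := norm_gdWeights_sub_le hm hN hx y h.sign hη hlam hlam1 hηN
    (empiricalGram_coercive hN hlam h.gram) hB hDR l
  refine isKnnGraphIso_of_distortion hε0 hε1 hX _ fun p hp q hq hpq => ?_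
  refine linearLayer_distortion hε0 hε1 hpq (h.distortion p hp q hq hpq) ?_
  exact (norm_linearLayer_sub_le hm hD0 hmove _).trans (by gcongr)

theorem initLaw_real_fst {m n : ℕ} (s : Set (Fin m → Fin n → ℝ)) :
    (initLaw m n).real {p | p.1 ∈ s} = (weightLaw m n).real s := by
  have h : {p : (Fin m → Fin n → ℝ) × (Fin m → ℝ) | p.1 ∈ s} = s ×ˢ Set.univ := by
    ext p; simp
  rw [h, measureReal_def, measureReal_def, initLaw, Measure.prod_prod, measure_univ, mul_one]

theorem initLaw_real_not_sign (m n : ℕ) :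
    (initLaw m n).real {p | ¬∀ r, |p.2 r| = 1} = 0 := by
  have h : {p : (Fin m → Fin n → ℝ) × (Fin m → ℝ) | ¬∀ r, |p.2 r| = 1}
      = Set.univ ×ˢ {a | ¬∀ r, |a r| = 1} := by
    ext p; simp
  rw [h, measureReal_def, initLaw, Measure.prod_prod, ae_iff.1 (ae_abs_pi_signLaw m), mul_zero,
    ENNReal.toReal_zero]

/-- The union bound over the ways in which an initialization can fail to be good. -/
theorem initLaw_not_goodInit_le {m n N : ℕ} (hm : 0 < m) (hN : 0 < N)
    {x : Fin N → EuclideanSpace ℝ (Fin n)} (hx : ∀ i, ‖x i‖ = 1)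
    {y : EuclideanSpace ℝ (Fin N)} {C : ℝ} (hy : ∀ i, |y i| ≤ C)
    (X : Finset (EuclideanSpace ℝ (Fin n))) {ε R M : ℝ} (hε0 : 0 < ε) (hε1 : ε < 1)
    (hlam : 0 < gramMinEigenvalue x) (hR : 0 ≤ R) (hM : 0 < M) :
    (initLaw m n).real {p | ¬GoodInit x y X ε R (2 * (M + N * C ^ 2)) (Matrix.of p.1) p.2}
      ≤ 16 * N ^ 4 / (m * gramMinEigenvalue x ^ 2) + 16 * N ^ 2 * R / gramMinEigenvalue x + N / M
        + X.card * (X.card - 1) * Real.exp (m / 4 * (ε ^ 3 / 8 - ε ^ 2 / 4)) := by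
  have hm' : (0 : ℝ) < m := by exact_mod_cast hm
  have hN' : (0 : ℝ) < N := by exact_mod_cast hN
  set lam := gramMinEigenvalue x with hlam_def
  set E₁ : Set (Fin m → Fin n → ℝ) := ⋃ i : Fin N, ⋃ j : Fin N,
    {W | lam / (4 * N) ≤ |empiricalGram x (Matrix.of W) i j - gramMatrix x i j|} with hE₁
  set E₂ : Set (Fin m → Fin n → ℝ) :=
    {W | m * lam / (16 * N) ≤ ∑ i, ∑ r, nearKink R (W r ⬝ᵥ (x i).ofLp)} with hE₂
  set E₃ : Set ((Fin m → Fin n → ℝ) × (Fin m → ℝ)) :=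
    {p | 2 * (M + N * C ^ 2) ≤ ‖predictions x p.2 (Matrix.of p.1) - y‖ ^ 2} with hE₃
  set E₄ : Set (Fin m → Fin n → ℝ) := {W | ∃ p ∈ X, ∃ q ∈ X, p ≠ q ∧
        ¬((1 - ε / 2) * ‖p - q‖ ^ 2 ≤ ‖linearLayer (Matrix.of W) (p - q)‖ ^ 2 ∧
          ‖linearLayer (Matrix.of W) (p - q)‖ ^ 2 ≤ (1 + ε / 2) * ‖p - q‖ ^ 2)} with hE₄
  have h1 : (initLaw m n).real {p | p.1 ∈ E₁} ≤ 16 * N ^ 4 / (m * lam ^ 2) := by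
    rw [initLaw_real_fst]
    have hij : ∀ i j : Fin N, (weightLaw m n).real
        {W | lam / (4 * N) ≤ |empiricalGram x (Matrix.of W) i j - gramMatrix x i j|}
          ≤ 16 * N ^ 2 / (m * lam ^ 2) := by
      intro i j
      refine (weightLaw_gram_deviation_le hm hx i j (by positivity)).trans (le_of_eq ?_)
      field_simp
      norm_num
    have hi : ∀ i : Fin N, (weightLaw m n).real (⋃ j : Fin N,
        {W | lam / (4 * N) ≤ |empiricalGram x (Matrix.of W) i j - gramMatrix x i j|})
          ≤ N * (16 * N ^ 2 / (m * lam ^ 2)) := by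
      intro i
      refine (measureReal_iUnion_fintype_le _).trans ?_
      simpa using Finset.sum_le_card_nsmul Finset.univ _ _ fun j _ => hij i j
    refine (measureReal_iUnion_fintype_le _).trans ?_
    refine (Finset.sum_le_card_nsmul Finset.univ _ _ fun i _ => hi i).trans (le_of_eq ?_)
    rw [Finset.card_univ, Fintype.card_fin, nsmul_eq_mul]
    ring
  have h2 : (initLaw m n).real {p | p.1 ∈ E₂} ≤ 16 * N ^ 2 * R / lam := by
    rw [initLaw_real_fst]
    refine (weightLaw_nearKink_le hx hR (by positivity)).trans (le_of_eq ?_)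
    field_simp
  have h3 : (initLaw m n).real E₃ ≤ N / M := initLaw_residual_le hm hx hy hM
  have h4 : (initLaw m n).real {p | p.1 ∈ E₄}
      ≤ X.card * (X.card - 1) * Real.exp (m / 4 * (ε ^ 3 / 8 - ε ^ 2 / 4)) := by
    rw [initLaw_real_fst]
    refine (weightLaw_distortion_le hm (by positivity) (by linarith) X).trans (le_of_eq ?_)
    congr 2
    ring
  have h5 := initLaw_real_not_sign m n
  have hsub : {p : (Fin m → Fin n → ℝ) × (Fin m → ℝ) |
        ¬GoodInit x y X ε R (2 * (M + N * C ^ 2)) (Matrix.of p.1) p.2}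
      ⊆ ((({p | p.1 ∈ E₁} ∪ {p | p.1 ∈ E₂}) ∪ E₃) ∪ {p | p.1 ∈ E₄})
        ∪ {p | ¬∀ r, |p.2 r| = 1} := by
    intro p hp
    by_contra hcon
    simp only [Set.mem_union, not_or, Set.mem_ofPred_eq, not_not] at hcon
    obtain ⟨⟨⟨⟨c1, c2⟩, c3⟩, c4⟩, c5⟩ := hcon
    refine hp ⟨c5, fun i j => ?_, ?_, ?_, fun p' hp' q' hq' hpq => ?_⟩
    · simp only [hE₁, Set.mem_iUnion, not_exists, Set.mem_ofPred_eq, not_le] at c1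
      exact (c1 i j).le
    · exact (not_le.1 c2).le
    · exact (not_le.1 c3).le
    · by_contra hn
      exact c4 ⟨p', hp', q', hq', hpq, hn⟩
  refine (measureReal_mono hsub (measure_ne_top _ _)).trans ?_
  refine (measureReal_union_le _ _).trans ?_
  rw [h5, add_zero]
  refine (measureReal_union_le _ _).trans (add_le_add ?_ h4)
  refine (measureReal_union_le _ _).trans (add_le_add ?_ h3)
  exact (measureReal_union_le _ _).trans (add_le_add h1 h2)

theorem pos_of_gramMinEigenvalue_pos {n N : ℕ} {x : Fin N → EuclideanSpace ℝ (Fin n)}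
    (h : 0 < gramMinEigenvalue x) : 0 < N := by
  rcases Nat.eq_zero_or_pos N with rfl | hN
  · simp [gramMinEigenvalue, spectrum.of_subsingleton] at h
  · exact hN

end FeatureGeometry

theorem mainTheorem2 :
    ∃ κ : ℝ, 0 < κ ∧ ∀ C : ℝ, ∃ K : ℝ, 0 < K ∧
      ∀ (n m N k : ℕ) (X : Finset (EuclideanSpace ℝ (Fin n)))
        (x : Fin N → EuclideanSpace ℝ (Fin n)) (y : EuclideanSpace ℝ (Fin N)) (ε δ η : ℝ),
        0 < ε → ε < 1 →
        (∀ p ∈ X, knnRadius k X p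
          ≤ ENNReal.ofReal ((1 - ε) / (1 + ε)) * knnRadius (k + 1) X p) →
        0 < gramMinEigenvalue x →
        (∀ i, ‖x i‖ = 1) →
        (∀ i, |y i| ≤ C) →
        0 < δ →
        K * ((N : ℝ) ^ 6 / (gramMinEigenvalue x ^ 4 * δ ^ 3)) ≤ (m : ℝ) →
        0 < η → η ≤ κ * (gramMinEigenvalue x / (N : ℝ) ^ 2) →
        1 - δ - (X.card : ℝ) * ((X.card : ℝ) - 1)
            * Real.exp ((m : ℝ) / 4 * (ε ^ 3 / 8 - ε ^ 2 / 4))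
          ≤ (initLaw m n).real
            {p : (Fin m → Fin n → ℝ) × (Fin m → ℝ) |
              64 * (N : ℝ) * ‖predictions x p.2 (Matrix.of p.1) - y‖ ^ 2
                  / (ε ^ 2 * gramMinEigenvalue x ^ 2) ≤ (m : ℝ) →
              ∀ l : ℕ, IsKnnGraphIso k (X : Set (EuclideanSpace ℝ (Fin n)))
                (linearLayer (gdWeights x y η p.2 (Matrix.of p.1) l))} := by
  refine ⟨1 / 10, by norm_num, fun C => ⟨221184 * (1 + C ^ 2), by positivity, ?_⟩⟩
  intro n m N k X x y ε δ η hε0 hε1 hX hlam hx hy hδ hmK hη hηκ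
  have hN := pos_of_gramMinEigenvalue_pos hlam
  have hN1 : (1 : ℝ) ≤ N := by exact_mod_cast hN
  have hlam1 := gramMinEigenvalue_le_one hN hx
  have hcard : 0 ≤ (X.card : ℝ) * ((X.card : ℝ) - 1) := by
    rcases Nat.eq_zero_or_pos X.card with h0 | h0
    · simp [h0]
    · have h1 : (1 : ℝ) ≤ X.card := by exact_mod_cast h0
      exact mul_nonneg (by linarith) (by linarith)
  have hexp := mul_nonneg hcard (Real.exp_pos ((m : ℝ) / 4 * (ε ^ 3 / 8 - ε ^ 2 / 4))).le
  rcases le_or_gt 1 δ with hδ1 | hδ1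
  · exact le_trans (by linarith) measureReal_nonneg
  set lam := gramMinEigenvalue x with hlam_def
  -- the width assumption, cleared of denominators
  have hmK' : 221184 * (1 + C ^ 2) * (N : ℝ) ^ 6 ≤ m * (lam ^ 4 * δ ^ 3) := by
    rwa [← mul_div_assoc, div_le_iff₀ (by positivity)] at hmK
  have hm' : (0 : ℝ) < m := by
    have h0 : 0 < 221184 * (1 + C ^ 2) * (N : ℝ) ^ 6 := by positivity
    exact pos_of_mul_pos_left (h0.trans_le hmK') (by positivity)
  have hm : 0 < m := by exact_mod_cast hm'
  -- the radius for which the second error term below equals `δ / 3`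
  set R := δ * lam / (48 * (N : ℝ) ^ 2) with hR
  have hηN : η * (N : ℝ) ^ 2 ≤ lam / 10 := by
    rw [← mul_div_assoc, le_div_iff₀ (by positivity)] at hηκ
    linarith
  have hbad := initLaw_not_goodInit_le (m := m) hm hN hx hy X (ε := ε) (R := R)
    (M := 3 * N / δ) hε0 hε1 hlam (by positivity) (by positivity)
  -- this is where the powers of `N`, `λ₀` and `δ` in the width assumption are used up
  have hRM : 16 * N * (2 * (3 * N / δ + N * C ^ 2)) ≤ R ^ 2 * (m * lam ^ 2) := by
    have h1 : N * C ^ 2 ≤ N * C ^ 2 / δ := le_div_self (by positivity) hδ hδ1.le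
    calc 16 * N * (2 * (3 * N / δ + N * C ^ 2))
        ≤ 16 * N * (2 * (3 * N / δ + N * C ^ 2 / δ)) := by gcongr
      _ ≤ 16 * N * (2 * (3 * N / δ + 3 * (N * C ^ 2 / δ))) := by
          have h2 : 0 ≤ N * C ^ 2 / δ := by positivity
          gcongr
          linarith
      _ = 221184 * (1 + C ^ 2) * (N : ℝ) ^ 6 / (2304 * N ^ 4 * δ) := by
          field_simp
          ring
      _ ≤ m * (lam ^ 4 * δ ^ 3) / (2304 * N ^ 4 * δ) := by gcongr
      _ = R ^ 2 * (m * lam ^ 2) := by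
          rw [hR]
          field_simp
          ring
  have h1 : 16 * (N : ℝ) ^ 4 / (m * lam ^ 2) ≤ δ / 3 := by
    rw [div_le_div_iff₀ (by positivity) (by norm_num)]
    have h2 : lam ^ 4 * δ ^ 3 ≤ lam ^ 2 * δ := by
      have h3 : lam ^ 4 ≤ lam ^ 2 := pow_le_pow_of_le_one hlam.le hlam1 (by norm_num)
      have h4 : δ ^ 3 ≤ δ := pow_le_of_le_one hδ.le hδ1.le (by norm_num)
      gcongr
    calc 16 * (N : ℝ) ^ 4 * 3 = 48 * (N : ℝ) ^ 4 := by ring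
      _ ≤ 221184 * (1 + C ^ 2) * (N : ℝ) ^ 6 := by
          have h3 : (N : ℝ) ^ 4 ≤ (N : ℝ) ^ 6 := pow_le_pow_right₀ hN1 (by norm_num)
          have h4 : (48 : ℝ) ≤ 221184 * (1 + C ^ 2) := by nlinarith [sq_nonneg C]
          gcongr
      _ ≤ m * (lam ^ 4 * δ ^ 3) := hmK'
      _ ≤ m * (lam ^ 2 * δ) := by gcongr
      _ = δ * (m * lam ^ 2) := by ring
  have h2 : 16 * (N : ℝ) ^ 2 * R / lam = δ / 3 := by
    rw [hR]
    field_simp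
    norm_num
  have h3 : (N : ℝ) / (3 * N / δ) = δ / 3 := by field_simp
  rw [h2, h3] at hbad
  -- the event need not be measurable: subadditivity bounds it from below by its complement
  set S := {p : (Fin m → Fin n → ℝ) × (Fin m → ℝ) |
    64 * (N : ℝ) * ‖predictions x p.2 (Matrix.of p.1) - y‖ ^ 2 / (ε ^ 2 * lam ^ 2) ≤ (m : ℝ) →
      ∀ l : ℕ, IsKnnGraphIso k (X : Set (EuclideanSpace ℝ (Fin n)))
        (linearLayer (gdWeights x y η p.2 (Matrix.of p.1) l))} with hS
  have hcover : Set.univ ⊆ S ∪ {p | ¬GoodInit x y X ε R (2 * (3 * N / δ + N * C ^ 2))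
      (Matrix.of p.1) p.2} := by
    intro p _
    by_cases hp : GoodInit x y X ε R (2 * (3 * N / δ + N * C ^ 2)) (Matrix.of p.1) p.2
    · exact Or.inl fun hwidth l =>
        hp.isKnnGraphIso hm hN hx hε0 hε1 hX hlam hη hηN (by positivity) hRM hwidth l
    · exact Or.inr hp
  have htotal := (measureReal_mono (μ := initLaw m n) hcover (measure_ne_top _ _)).trans
    (measureReal_union_le _ _)
  rw [probReal_univ] at htotal
  linarith
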